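/- **Theorem (closed form of $\mathcal B_{\mathrm{reg}}$).** *Notation.* Let $\mathcal M^{(2)}$ be the set of non-negative Borel measures $\nu$ on $\mathbb R$ with $\int (1+s^2)^{-1}\,d\nu(s)<\infty$. For $\nu\in\mathcal M^{(2)}$ and $z$ in the open upper half-plane $\mathbb H$ put $$Q_{\mathrm{reg}}[\nu](z)=\int \frac{i}{\pi}\Big(\frac1{z-s}+\frac{s}{1+s^2}\Big)\,d\nu(s).$$ Given $\lambda\in\mathcal M^{(2)}$, $\lambda\neq 0$, $c_0\in\mathbb R$ and $c_1\ge 0$, write $\mathcal B_{\mathrm{reg}}[\lambda,c_0,c_1]=(\mu,\zeta_0,\zeta_1)$ if $\mu\in\mathcal M^{(2)}$ (possibly $\mu=0$), $\zeta_0\in\mathbb R$, $\zeta_1\ge 0$ and $$\big(Q_{\mathrm{reg}}[\lambda](z)-i\pi^{-1}(c_0+c_1z)\big)\big(Q_{\mathrm{reg}}[\mu](z)-i\pi^{-1}(\zeta_0+\zeta_1z)\big)=1\qquad(z\in\mathbb H).$$ For a finite non-negative Borel measure $\nu$ on $S^1$ let $Q[\nu](z)=\int\frac{1+e^{-i\theta}z}{1-e^{-i\theta}z}\,d\nu(\theta)$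 for $|z|<1$, and $H[\nu](w)=\lim_{r\to1^-}\operatorname{Im}Q[\nu](rw)$ for those $w\in S^1$ at which the limit exists. Let $\phi^{-1}(s)=\frac{i-s}{i+s}$ be the Cayley map $\mathbb R\to S^1\setminus\{-1\}$, let $\psi[\lambda]$ be the push-forward of $\frac{d\lambda(s)}{\pi(1+s^2)}$ under $\phi^{-1}$, and put $H_{\mathrm{reg}}[\lambda](s)=H[\psi[\lambda]](\phi^{-1}(s))$, $\widetilde\lambda=\psi[\lambda]+\pi^{-1}c_1\delta_{-1}$ and $\widetilde c_0=-\pi^{-1}c_0$. The zero sets are $$N_0(\lambda)=\bigcap_{\varepsilon>0}\operatorname{clos}\Big\{s\in\mathbb R:\limsup_{\delta\to0^+}\frac{\lambda([s-\delta,s+\delta])}{2\delta}<\varepsilon\Big\},\qquad N_0(\widetilde\lambda)=\bigcap_{\varepsilon>0}\operatorname{clos}\Big\{w\in S^1:\limsup_{\delta\to0^+}\frac{\widetilde\lambda(\{we^{it}:|t|\le\delta\})}{2\delta}<\varepsilon\Big\}.$$ Let $\lambda_c$ be the density of the absolutely continuous part of $\lambda$ with respect to Lebesgue measure. *Statement.*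 Let $\lambda\in\mathcal M^{(2)}$, $\lambda\ne0$, $c_0\in\mathbb R$, $c_1\ge0$, and suppose that $$Z'=\big(N_0(\widetilde\lambda)\cap\operatorname{supp}\widetilde\lambda\big)\cup\{z\in S^1\setminus\operatorname{supp}\widetilde\lambda : H[\widetilde\lambda](z)+\widetilde c_0=0\}$$ is discrete, i.e. contains none of its limit points. Then there is exactly one triple $(\mu,\zeta_0,\zeta_1)=\mathcal B_{\mathrm{reg}}[\lambda,c_0,c_1]$; the limit defining $H_{\mathrm{reg}}[\lambda](s)$ exists for almost every $s\in\mathbb R$; the set $$Z=N_0(\lambda)\cap\{s\in\mathbb R: H_{\mathrm{reg}}[\lambda](s)\text{ exists and } H_{\mathrm{reg}}[\lambda](s)-\pi^{-1}(c_1s+c_0)=0\}$$ is countable; and $$d\mu(s)=\frac{\lambda_c(s)}{\lambda_c(s)^2+\big(H_{\mathrm{reg}}[\lambda](s)-\pi^{-1}(c_1s+c_0)\big)^2}\,ds+\sum_{\alpha\in Z}\beta_\alpha\,\delta_\alpha,\qquad \beta_\alpha=\pi^2\Big(c_1+\int\frac{d\lambda(\tau)}{(\tau-\alpha)^2}\Big)^{-1},$$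 where $\beta_\alpha=0$ if the integral is infinite. Furthermore $$\zeta_0=-\pi^2\,\operatorname{Im}\Big[\Big(\int\frac{d\lambda(s)}{1+s^2}+c_1-ic_0\Big)^{-1}\Big].$$ Finally, write $\|\lambda\|=\lambda(\mathbb R)$. If $c_1=0$, $\|\lambda\|<\infty$ and $c_0=\int\frac{s}{1+s^2}\,d\lambda(s)$, then $\zeta_1=\pi^2/\|\lambda\|$; in all other cases $\zeta_1=0$. -/

import Mathlib

open MeasureTheory Filter Topology

noncomputable section

/-! ### Measures on the circle -/

instance instMeasurableSpaceCircle : MeasurableSpace Circle := borel Circle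

instance instBorelSpaceCircle : BorelSpace Circle := ⟨rfl⟩

/-- The Cauchy transform `Q[ν](z) = ∫ (1 + e^{-iθ} z) / (1 - e^{-iθ} z) dν(θ)` on the unit disc;
a point of the circle is `w = e^{iθ}`, so that `e^{-iθ} = w⁻¹`. -/
def cauchyCircle (ν : Measure Circle) (z : ℂ) : ℂ :=
  ∫ w : Circle, (1 + (w : ℂ)⁻¹ * z) / (1 - (w : ℂ)⁻¹ * z) ∂ν

/-- The Hilbert transform `H[ν]` exists at `w` as a radial limit and equals `h` there:
`Im Q[ν](r w) → h` as `r → 1⁻`. -/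
def HasHilbertCircle (ν : Measure Circle) (w : Circle) (h : ℝ) : Prop :=
  Tendsto (fun r : ℝ => (cauchyCircle ν ((r : ℂ) * (w : ℂ))).im) (𝓝[<] 1) (𝓝 h)

/-- The Hilbert transform `H[ν](w) = lim_{r → 1⁻} Im Q[ν](r w)` (arbitrary where the limit does
not exist). -/
def hilbertCircle (ν : Measure Circle) (w : Circle) : ℝ :=
  limUnder (𝓝[<] (1 : ℝ)) (fun r : ℝ => (cauchyCircle ν ((r : ℂ) * (w : ℂ))).im)

/-- The closed arc of half-length `δ` centred at `w`. -/
def circleArc (w : Circle) (δ : ℝ) : Set Circle :=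
  (fun t : ℝ => w * Circle.exp t) '' Set.Icc (-δ) δ

/-- The zero set `N₀(ν)` of a measure on the circle. -/
def zeroSetCircle (ν : Measure Circle) : Set Circle :=
  ⋂ (ε : ℝ) (_ : 0 < ε), closure {w : Circle |
    limsup (fun δ : ℝ => ν (circleArc w δ) / ENNReal.ofReal (2 * δ)) (𝓝[>] 0)
      < ENNReal.ofReal ε}

/-- A set is discrete if it contains none of its limit points. -/
def IsDiscreteSubset (S : Set Circle) : Prop :=
  ∀ z ∈ S, ∃ ε : ℝ, 0 < ε ∧ ∀ z' ∈ S, z' ≠ z → ε < dist z z'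

/-! ### Measures on the line -/

/-- The weighted finiteness condition `∫ (1 + s²)⁻¹ dν(s) < ∞`. -/
def MemM2 (ν : Measure ℝ) : Prop :=
  ∫⁻ s, ENNReal.ofReal ((1 + s ^ 2)⁻¹) ∂ν < ⊤

/-- The inverse Cayley map `φ⁻¹(s) = (i - s) / (i + s)` from the real line to the circle; its range
misses only `-1`, which corresponds to `∞`. -/
def cayleyInv (s : ℝ) : Circle :=
  ⟨(Complex.I - s) / (Complex.I + s), by
    have h : ‖Complex.I - (s : ℂ)‖ = ‖Complex.I + (s : ℂ)‖ := by
      rw [Complex.norm_def, Complex.norm_def]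
      congr 1
      simp [Complex.normSq_apply]
    have h0 : ‖Complex.I + (s : ℂ)‖ ≠ 0 := by
      rw [norm_ne_zero_iff]
      intro h1
      have := congrArg Complex.im h1
      simp at this
    exact mem_sphere_zero_iff_norm.mpr (by rw [norm_div, h, div_self h0])⟩

/-- The embedding `ψ`, determined by `dν(s) = π (1 + s²) φ_* ψ[ν](ds)`. -/
def psi (ν : Measure ℝ) : Measure Circle :=
  (ν.withDensity (fun s => ENNReal.ofReal ((Real.pi * (1 + s ^ 2))⁻¹))).map cayleyInv

/-- `Ψ_reg[ν, c₀, c₁] = (ψ[ν] + π⁻¹ c₁ δ_{-1}, -π⁻¹ c₀)`. -/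
def psiReg (ν : Measure ℝ) (c₀ c₁ : ℝ) : Measure Circle × ℝ :=
  (psi ν + ENNReal.ofReal (Real.pi⁻¹ * c₁) • Measure.dirac (-1 : Circle), -(Real.pi⁻¹ * c₀))

/-- The regularized Cauchy transform on the upper half-plane. -/
def cauchyReg (ν : Measure ℝ) (z : ℂ) : ℂ :=
  ∫ s : ℝ, Complex.I / Real.pi * (1 / (z - s) + s / (1 + (s : ℂ) ^ 2)) ∂ν

/-- The regularized Hilbert transform `H_reg[ν](t) = H[ψ[ν]](φ⁻¹(t))` exists and equals `h`. -/
def HasHilbertReg (ν : Measure ℝ) (t h : ℝ) : Prop :=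
  HasHilbertCircle (psi ν) (cayleyInv t) h

/-- The regularized Hilbert transform `H_reg[ν](t) = H[ψ[ν]](φ⁻¹(t))`. -/
def hilbertReg (ν : Measure ℝ) (t : ℝ) : ℝ :=
  hilbertCircle (psi ν) (cayleyInv t)

/-- The zero set `N₀(ν)` of a measure on the line. -/
def zeroSetLine (ν : Measure ℝ) : Set ℝ :=
  ⋂ (ε : ℝ) (_ : 0 < ε), closure {s : ℝ |
    limsup (fun δ : ℝ => ν (Set.Icc (s - δ) (s + δ)) / ENNReal.ofReal (2 * δ)) (𝓝[>] 0)
      < ENNReal.ofReal ε}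

/-- `(μ, ζ₀, ζ₁) = B_reg[ν, c₀, c₁]`: the measure `μ` has `∫ (1 + s²)⁻¹ dμ(s) < ∞`, `ζ₁ ≥ 0`, and
`(Q_reg[ν](z) - iπ⁻¹(c₀ + c₁ z)) (Q_reg[μ](z) - iπ⁻¹(ζ₀ + ζ₁ z)) = 1` on the upper half-plane. -/
def IsBreg (ν : Measure ℝ) (c₀ c₁ : ℝ) (T : Measure ℝ × ℝ × ℝ) : Prop :=
  MemM2 T.1 ∧ 0 ≤ T.2.2 ∧ ∀ z : ℂ, 0 < z.im →
    (cauchyReg ν z - Complex.I * (Real.pi : ℂ)⁻¹ * (c₀ + c₁ * z)) *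
      (cauchyReg T.1 z - Complex.I * (Real.pi : ℂ)⁻¹ * (T.2.1 + T.2.2 * z)) = 1

/-- The set `Z' = (N₀(ν̃) ∩ supp ν̃) ∪ {z ∉ supp ν̃ | H[ν̃](z) + c̃₀ = 0}` on the circle, where
`(ν̃, c̃₀) = Ψ_reg[ν, c₀, c₁]`. -/
def criticalSetCircle (ν : Measure ℝ) (c₀ c₁ : ℝ) : Set Circle :=
  (zeroSetCircle (psiReg ν c₀ c₁).1 ∩ (psiReg ν c₀ c₁).1.support) ∪
    {z | z ∉ (psiReg ν c₀ c₁).1.support ∧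
      HasHilbertCircle (psiReg ν c₀ c₁).1 z (-(psiReg ν c₀ c₁).2)}

/-- The set `Z = N₀(ν) ∩ {s | H_reg[ν](s) - π⁻¹(c₁ s + c₀) = 0}` of possible atoms. -/
def atomSet (ν : Measure ℝ) (c₀ c₁ : ℝ) : Set ℝ :=
  zeroSetLine ν ∩ {s | HasHilbertReg ν s (Real.pi⁻¹ * (c₁ * s + c₀))}

/-- The density `λ_c` of the absolutely continuous part, with respect to Lebesgue measure. -/
def acDensity (ν : Measure ℝ) (s : ℝ) : ℝ :=
  (ν.rnDeriv volume s).toReal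

/-- The weight `π² (c₁ + ∫ (τ - α)⁻² dν(τ))⁻¹`, with `1 / 0 = ∞` inside the integral and
`1 / ∞ = 0` outside. -/
def atomWeight (ν : Measure ℝ) (c₁ α : ℝ) : ENNReal :=
  ENNReal.ofReal (Real.pi ^ 2) *
    (ENNReal.ofReal c₁ + ∫⁻ τ, (ENNReal.ofReal ((τ - α) ^ 2))⁻¹ ∂ν)⁻¹

end

/-! ### The Herglotz representation on the disc -/

/-! Put F = `nevanlinna lam c₀ c₁`. Its real part is a Poisson integral of λ plus a non-negative
multiple of Im z, so it is positive because λ ≠ 0. Hence G = 1/F is holomorphic with positive real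
part on the half-plane. The Herglotz theorem, moved by the Cayley map (`exists_nevanlinna_eq`),
writes G as `nevanlinna μ ζ₀ ζ₁`. This is existence.

The triple is then recovered from the boundary behaviour of G. Absolutely continuous part: by
Fatou's theorem (`ae_tendsto_poissonInt`) Re G tends nontangentially to the density of μ almost
everywhere. F also has nontangential limits almost everywhere (`ae_exists_tendsto_of_re_pos`), with
real part λ_c and imaginary part H_reg − π⁻¹(c₁s + c₀), so the density of μ is the real part of the
reciprocal. Singular part: for almost every point with respect to it, Re G tends to infinity
(`ae_singularPart_tendsto_poissonInt`). So F tends to 0 there, and the point lies in Z. The Cayley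
map sends Z injectively into the discrete, hence countable, set Z'. The singular part is therefore a
sum of point masses. Atoms: (z − α)G(z) tends to (i/π)μ{α}, and it is the reciprocal of F(z)/(z −
α), whose limit is governed by c₁ + ∫(τ − α)⁻² dλ (`measure_singleton_eq_atomWeight`). Constants: ζ₀
comes from the value at i, and ζ₁ from G(iy)/(iy) as y → ∞.

These formulas involve only λ, c₀ and c₁, so they also give uniqueness. -/

lemma cauchyCircle_kernel_eq (w : Circle) (z : ℂ) :
    (1 + (w : ℂ)⁻¹ * z) / (1 - (w : ℂ)⁻¹ * z) = (w + z) / (w - z) := by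
  have hw : (w : ℂ) ≠ 0 := w.coe_ne_zero
  rw [← mul_div_mul_left (1 + (w : ℂ)⁻¹ * z) (1 - (w : ℂ)⁻¹ * z) hw]
  congr 1 <;> field_simp

lemma cauchyCircle_eq (ν : Measure Circle) (z : ℂ) :
    cauchyCircle ν z = ∫ w : Circle, ((w : ℂ) + z) / (w - z) ∂ν := by
  simp only [cauchyCircle, cauchyCircle_kernel_eq]

lemma one_sub_norm_le_norm_circle_sub (w : Circle) (z : ℂ) : 1 - ‖z‖ ≤ ‖(w : ℂ) - z‖ := by
  simpa only [Circle.norm_coe] using norm_sub_norm_le (w : ℂ) z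

lemma circle_sub_ne_zero (w : Circle) {z : ℂ} (hz : ‖z‖ < 1) : (w : ℂ) - z ≠ 0 := by
  have := one_sub_norm_le_norm_circle_sub w z
  exact norm_pos_iff.1 (by linarith)

lemma continuous_cauchyCircle_kernel {z : ℂ} (hz : ‖z‖ < 1) :
    Continuous fun w : Circle => ((w : ℂ) + z) / (w - z) :=
  (by fun_prop : Continuous fun w : Circle => (w : ℂ) + z).div (by fun_prop)
    fun w => circle_sub_ne_zero w hz

lemma integrable_cauchyCircle_kernel (ν : Measure Circle) [IsFiniteMeasure ν] {z : ℂ}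
    (hz : ‖z‖ < 1) : Integrable (fun w : Circle => ((w : ℂ) + z) / (w - z)) ν :=
  (continuous_cauchyCircle_kernel hz).integrable_of_hasCompactSupport
    (HasCompactSupport.of_compactSpace _)

lemma differentiableOn_cauchyCircle (ν : Measure Circle) [IsFiniteMeasure ν] :
    DifferentiableOn ℂ (cauchyCircle ν) (Metric.ball 0 1) := by
  intro z hz
  have hz' : ‖z‖ < 1 := by simpa using hz
  refine DifferentiableAt.differentiableWithinAt ?_
  rw [show cauchyCircle ν = fun z => ∫ w : Circle, ((w : ℂ) + z) / (w - z) ∂ν from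
    funext (cauchyCircle_eq ν)]
  -- Half the distance to the circle: on the ball of radius d about z the denominators stay at least
  -- d.
  set d := (1 - ‖z‖) / 2 with hd
  have hd0 : 0 < d := by rw [hd]; linarith
  have hlt : ∀ x ∈ Metric.ball z d, ‖x‖ ≤ 1 - d := fun x hx => by
    have h1 : ‖x - z‖ < d := by simpa [dist_eq_norm] using hx
    have h2 : ‖x‖ - ‖z‖ ≤ ‖x - z‖ := norm_sub_norm_le x z
    have h3 : ‖z‖ = 1 - 2 * d := by rw [hd]; ring
    linarith
  refine (hasDerivAt_integral_of_dominated_loc_of_deriv_le (μ := ν)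
    (F' := fun x (w : Circle) => 2 * (w : ℂ) / (w - x) ^ 2) (bound := fun _ => 2 / d ^ 2)
    (Metric.ball_mem_nhds z hd0) ?_ (integrable_cauchyCircle_kernel ν hz') ?_ ?_
    (integrable_const _) ?_).2.differentiableAt
  · filter_upwards [Metric.ball_mem_nhds z hd0] with x hx
    exact (continuous_cauchyCircle_kernel (by linarith [hlt x hx])).aestronglyMeasurable
  · refine Continuous.aestronglyMeasurable (Continuous.div (by fun_prop) (by fun_prop)
      fun w => pow_ne_zero 2 (circle_sub_ne_zero w hz'))
  · filter_upwards with w x hx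
    have h1 := one_sub_norm_le_norm_circle_sub w x
    have h2 := hlt x hx
    rw [norm_div, norm_pow, norm_mul, Circle.norm_coe]
    norm_num
    gcongr
    linarith
  · filter_upwards with w x hx
    have hne : (w : ℂ) - x ≠ 0 := circle_sub_ne_zero w (by linarith [hlt x hx])
    have h := ((hasDerivAt_id' x).const_add (w : ℂ)).div ((hasDerivAt_id' x).const_sub (w : ℂ)) hne
    convert! h using 1
    congr 1
    ring

/-- The measure `f(e^{iθ}) dθ / 2π` on the circle. -/
noncomputable def circleDensity (f : ℂ → ℝ) : Measure Circle :=
  ((volume.restrict (Set.Ioc 0 (2 * Real.pi))).withDensity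
    fun θ => ENNReal.ofReal ((2 * Real.pi)⁻¹ * f (circleMap 0 1 θ))).map Circle.exp

lemma circleMap_zero_one (θ : ℝ) : circleMap 0 1 θ = Circle.exp θ := by
  simp [circleMap]

lemma continuous_comp_circleMap {f : ℂ → ℝ} (hf : ContinuousOn f (Metric.sphere 0 1)) :
    Continuous fun θ => f (circleMap 0 1 θ) :=
  hf.comp_continuous (continuous_circleMap 0 1) fun θ => circleMap_mem_sphere 0 zero_le_one θ

lemma integral_circleDensity {f : ℂ → ℝ} (hf : ContinuousOn f (Metric.sphere 0 1))
    (hf0 : ∀ z ∈ Metric.sphere (0 : ℂ) 1, 0 ≤ f z) {g : ℂ → ℝ}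
    (hg : Continuous fun w : Circle => g w) :
    ∫ w : Circle, g w ∂circleDensity f = Real.circleAverage (fun z => g z * f z) 0 1 := by
  have hc := continuous_comp_circleMap hf
  rw [circleDensity, integral_map Circle.exp.continuous.measurable.aemeasurable
    hg.aestronglyMeasurable, integral_withDensity_eq_integral_toReal_smul
    (by exact (hc.measurable.const_mul _).ennreal_ofReal) (by simp), Real.circleAverage_def,
    intervalIntegral.integral_of_le Real.two_pi_pos.le, ← integral_smul]
  refine integral_congr_ae (ae_of_all _ fun θ => ?_)
  have h0 := hf0 _ (circleMap_mem_sphere 0 zero_le_one θ)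
  have hpi := Real.pi_pos
  simp only [smul_eq_mul, circleMap_zero_one] at h0 ⊢
  rw [ENNReal.toReal_ofReal (by positivity)]
  ring

lemma isFiniteMeasure_circleDensity {f : ℂ → ℝ} (hf : ContinuousOn f (Metric.sphere 0 1)) :
    IsFiniteMeasure (circleDensity f) := by
  have hc : Continuous fun θ => (2 * Real.pi)⁻¹ * f (circleMap 0 1 θ) :=
    continuous_const.mul (continuous_comp_circleMap hf)
  have : IsFiniteMeasure ((volume.restrict (Set.Ioc 0 (2 * Real.pi))).withDensity
    fun θ => ENNReal.ofReal ((2 * Real.pi)⁻¹ * f (circleMap 0 1 θ))) := by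
    refine isFiniteMeasure_withDensity_ofReal (Integrable.hasFiniteIntegral ?_)
    exact (hc.integrableOn_Icc (a := 0) (b := 2 * Real.pi)).mono_set Set.Ioc_subset_Icc_self
  unfold circleDensity
  infer_instance

/-- When G is continuous up to the circle, its Herglotz measure is explicit. The general case
applies this to the dilates G(r·) and lets r → 1. -/
lemma integral_circleDensity_poisson {G : ℂ → ℂ} (hG : DiffContOnCl ℂ G (Metric.ball 0 1))
    (hG0 : ∀ z ∈ Metric.sphere (0 : ℂ) 1, 0 ≤ (G z).re) {z : ℂ} (hz : ‖z‖ < 1) :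
    ∫ w : Circle, (((w : ℂ) + z) / (w - z)).re ∂circleDensity (fun z => (G z).re) = (G z).re := by
  have hGc : ContinuousOn G (Metric.sphere 0 1) := hG.continuousOn_ball.mono
    Metric.sphere_subset_closedBall
  have hk : ContinuousOn (fun w : ℂ => ((w + z) / (w - z)).re) (Metric.sphere 0 1) := by
    refine Complex.continuous_re.comp_continuousOn (ContinuousOn.div (by fun_prop) (by fun_prop) ?_)
    intro w hw h
    rw [sub_eq_zero.1 h] at hw
    simp at hw
    linarith
  refine (integral_circleDensity (f := fun z => (G z).re) (g := fun w => ((w + z) / (w - z)).re)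
    (Complex.continuous_re.comp_continuousOn hGc) hG0
    (Complex.continuous_re.comp (continuous_cauchyCircle_kernel hz))).trans ?_
  have h := hG.circleAverage_re_herglotzRieszKernel_smul' (w := z) (by simpa using hz)
  simp only [sub_zero] at h
  have hci : CircleIntegrable (fun w : ℂ => ((w + z) / (w - z)).re • G w) 0 1 :=
    ContinuousOn.circleIntegrable zero_le_one (hk.smul hGc)
  have h2 := Complex.reCLM.circleAverage_comp_comm hci
  rw [h] at h2
  simpa [Function.comp_def] using h2

/-- The Herglotz representation theorem on the unit disc. -/
theorem exists_cauchyCircle_eq {G : ℂ → ℂ} (hG : DifferentiableOn ℂ G (Metric.ball 0 1))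
    (hG0 : ∀ z ∈ Metric.ball (0 : ℂ) 1, 0 ≤ (G z).re) :
    ∃ (ν : Measure Circle) (b : ℝ), IsFiniteMeasure ν ∧
      ∀ z ∈ Metric.ball (0 : ℂ) 1, G z = cauchyCircle ν z + Complex.I * b := by
  have hscale : ∀ r ∈ Set.Ioo (0 : ℝ) 1, ∀ z : ℂ, ‖z‖ ≤ 1 → (r : ℂ) * z ∈ Metric.ball (0 : ℂ) 1 := by
    intro r hr z hz
    simp only [mem_ball_zero_iff, norm_mul, Complex.norm_real, Real.norm_eq_abs, abs_of_pos hr.1]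
    nlinarith [hr.1, hr.2, norm_nonneg z]
  have hdc : ∀ r ∈ Set.Ioo (0 : ℝ) 1, DiffContOnCl ℂ (fun z => G (r * z)) (Metric.ball 0 1) := by
    intro r hr
    refine DifferentiableOn.diffContOnCl ?_
    rw [closure_ball _ one_ne_zero]
    exact hG.comp (by fun_prop) fun z hz => hscale r hr z (by simpa using hz)
  have hre : ∀ r ∈ Set.Ioo (0 : ℝ) 1, ∀ z ∈ Metric.sphere (0 : ℂ) 1, 0 ≤ (G (r * z)).re :=
    fun r hr z hz => hG0 _ (hscale r hr z (by simpa using (mem_sphere_zero_iff_norm.1 hz).le))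
  have hfin : ∀ r ∈ Set.Ioo (0 : ℝ) 1,
      IsFiniteMeasure (circleDensity fun z => (G (r * z)).re) := fun r hr =>
    isFiniteMeasure_circleDensity (Complex.continuous_re.comp_continuousOn
      ((hdc r hr).continuousOn_ball.mono Metric.sphere_subset_closedBall))
  classical
  let M : ℝ → FiniteMeasure Circle := fun r =>
    if hr : r ∈ Set.Ioo (0 : ℝ) 1 then ⟨_, hfin r hr⟩ else 0
  have hM : ∀ r ∈ Set.Ioo (0 : ℝ) 1, ∀ z : ℂ, ‖z‖ < 1 →
      ∫ w : Circle, (((w : ℂ) + z) / (w - z)).re ∂(M r : Measure Circle) = (G (r * z)).re := by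
    intro r hr z hz
    have h : M r = ⟨_, hfin r hr⟩ := dif_pos hr
    rw [h]
    exact integral_circleDensity_poisson (hdc r hr) (hre r hr) hz
  -- At z = 0 the kernel is 1, so every dilate has total mass Re G(0). The measures thus lie in a
  -- weakly compact set.
  have hmass : ∀ r ∈ Set.Ioo (0 : ℝ) 1, (M r).mass ≤ (G 0).re.toNNReal := by
    intro r hr
    have h := hM r hr 0 (by simp)
    have h1 : ∀ w : Circle, (((w : ℂ) + 0) / (w - 0)).re = 1 := fun w => by
      simp [w.coe_ne_zero]
    simp only [h1, integral_const, smul_eq_mul, mul_one, mul_zero] at h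
    rw [← NNReal.coe_le_coe]
    refine le_trans (le_of_eq ?_) (Real.le_coe_toNNReal _)
    rw [← h]
    rfl
  have hIoo : Set.Ioo (0 : ℝ) 1 ∈ 𝓝[<] (1 : ℝ) := Ioo_mem_nhdsLT zero_lt_one
  -- An ultrafilter finer than r → 1⁻ converges in a compact set, so no subsequence has to be
  -- extracted.
  let U : Ultrafilter ℝ := Ultrafilter.of (𝓝[<] (1 : ℝ))
  have hU : (U : Filter ℝ) ≤ 𝓝[<] 1 := Ultrafilter.of_le _
  obtain ⟨ν, -, hν⟩ := (isCompact_setOfPred_finiteMeasure_le_of_compactSpace Circle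
    (G 0).re.toNNReal).ultrafilter_le_nhds (U.map M) (by
      rw [le_principal_iff]
      exact Ultrafilter.mem_map.2 (mem_of_superset (hU hIoo) hmass))
  have hlim := (FiniteMeasure.tendsto_iff_forall_integral_tendsto (F := (U : Filter ℝ)) (μs := M)).1
    hν
  have hreal : ∀ z ∈ Metric.ball (0 : ℂ) 1, (G z).re = (cauchyCircle ν z).re := by
    intro z hz
    have hz' : ‖z‖ < 1 := by simpa using hz
    have h1 := hlim (BoundedContinuousFunction.mkOfCompact
      ⟨_, Complex.continuous_re.comp (continuous_cauchyCircle_kernel hz')⟩)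
    have h2 : Tendsto (fun r : ℝ => (G (r * z)).re) U (𝓝 (G z).re) := by
      refine Tendsto.mono_left ?_ hU
      have hc : ContinuousAt G z := (hG.differentiableAt (Metric.isOpen_ball.mem_nhds hz)).continuousAt
      have : Tendsto (fun r : ℝ => (r : ℂ) * z) (𝓝[<] 1) (𝓝 z) := by
        have : Continuous fun r : ℝ => (r : ℂ) * z := by fun_prop
        simpa using (this.tendsto 1).mono_left nhdsWithin_le_nhds
      exact (Complex.continuous_re.tendsto _).comp (hc.tendsto.comp this)
    have h3 := tendsto_nhds_unique (h2.congr' (by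
      filter_upwards [hU hIoo] with r hr using (hM r hr z hz').symm)) h1
    rw [h3, cauchyCircle_eq]
    exact integral_re (integrable_cauchyCircle_kernel (ν : Measure Circle) hz')
  -- The real parts agree on the connected disc, so the difference is an imaginary constant.
  obtain ⟨b, hb⟩ := AnalyticOnNhd.eq_re_add_const_mul_I_of_re_eq_const (c₀ := 0)
    (f := fun z => G z - cauchyCircle ν z) (U := Metric.ball (0 : ℂ) 1)
    ((hG.sub (differentiableOn_cauchyCircle ν)).analyticOnNhd Metric.isOpen_ball)
    (fun z hz => by simp [hreal z hz]) Metric.isOpen_ball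
    ((convex_ball (0 : ℂ) 1).isConnected ⟨0, by simp⟩)
  refine ⟨ν, b, inferInstance, fun z hz => ?_⟩
  have := hb z hz
  rw [Complex.ofReal_zero, zero_add] at this
  linear_combination this

/-! ### The Cayley transform -/

/-- The Cayley transform from the upper half-plane to the unit disc. -/
noncomputable def cayleyDisc (z : ℂ) : ℂ := (Complex.I - z) / (Complex.I + z)

/-- The Cayley transform from the unit disc to the upper half-plane. -/
noncomputable def cayleyPlane (ω : ℂ) : ℂ := Complex.I * (1 - ω) / (1 + ω)

lemma I_add_ne_zero {z : ℂ} (hz : 0 ≤ z.im) : Complex.I + z ≠ 0 := by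
  intro h
  have := congrArg Complex.im h
  simp at this
  linarith

lemma one_add_ne_zero_of_norm_lt {ω : ℂ} (h : ‖ω‖ < 1) : 1 + ω ≠ 0 := by
  intro h'
  rw [eq_neg_of_add_eq_zero_right h'] at h
  simp at h

lemma coe_cayleyInv (s : ℝ) : (cayleyInv s : ℂ) = cayleyDisc s := rfl

lemma norm_cayleyDisc_lt_one {z : ℂ} (hz : 0 < z.im) : ‖cayleyDisc z‖ < 1 := by
  have h0 : 0 < ‖Complex.I + z‖ := norm_pos_iff.2 (I_add_ne_zero hz.le)
  rw [cayleyDisc, norm_div, div_lt_one h0]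
  refine lt_of_pow_lt_pow_left₀ 2 (norm_nonneg _) ?_
  rw [← Complex.normSq_eq_norm_sq, ← Complex.normSq_eq_norm_sq]
  simp [Complex.normSq_apply]
  nlinarith

lemma cayleyPlane_cayleyDisc {z : ℂ} (hz : 0 ≤ z.im) : cayleyPlane (cayleyDisc z) = z := by
  have h := I_add_ne_zero hz
  have h2 : 1 + cayleyDisc z = 2 * Complex.I / (Complex.I + z) := by
    rw [cayleyDisc]; field_simp; ring
  have h1 : 1 - cayleyDisc z = 2 * z / (Complex.I + z) := by
    rw [cayleyDisc]; field_simp; ring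
  rw [cayleyPlane, h1, h2]
  field_simp

lemma I_add_cayleyPlane {ω : ℂ} (h : 1 + ω ≠ 0) :
    Complex.I + cayleyPlane ω = 2 * Complex.I / (1 + ω) := by
  rw [cayleyPlane]; field_simp; ring

lemma cayleyDisc_cayleyPlane {ω : ℂ} (h : 1 + ω ≠ 0) : cayleyDisc (cayleyPlane ω) = ω := by
  have h1 : Complex.I - cayleyPlane ω = 2 * Complex.I * ω / (1 + ω) := by
    rw [cayleyPlane]; field_simp; ring
  rw [cayleyDisc, I_add_cayleyPlane h, h1]
  field_simp

lemma im_cayleyPlane (ω : ℂ) :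
    (cayleyPlane ω).im = (1 - ‖ω‖ ^ 2) / ‖1 + ω‖ ^ 2 := by
  rw [cayleyPlane, Complex.div_im, ← Complex.normSq_eq_norm_sq, ← Complex.normSq_eq_norm_sq,
    ← sub_div]
  congr 1
  simp [Complex.normSq_apply]
  ring

lemma im_cayleyPlane_pos {ω : ℂ} (h : ‖ω‖ < 1) : 0 < (cayleyPlane ω).im := by
  rw [im_cayleyPlane]
  have h1 : 0 < ‖1 + ω‖ := norm_pos_iff.2 (one_add_ne_zero_of_norm_lt h)
  have h2 : 0 < 1 - ‖ω‖ ^ 2 := by nlinarith [norm_nonneg ω]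
  positivity

lemma continuous_cayleyInv : Continuous cayleyInv := by
  refine Continuous.subtype_mk (f := fun s : ℝ => (Complex.I - s) / (Complex.I + s)) ?_ _
  exact Continuous.div (by fun_prop) (by fun_prop) fun s => I_add_ne_zero (by simp)

lemma cayleyInv_injective : Function.Injective cayleyInv := by
  intro s t h
  have h1 : cayleyDisc s = cayleyDisc t := by rw [← coe_cayleyInv, ← coe_cayleyInv, h]
  have h2 := congrArg cayleyPlane h1
  rw [cayleyPlane_cayleyDisc (by simp), cayleyPlane_cayleyDisc (by simp)] at h2
  exact_mod_cast h2

lemma one_add_cayleyInv (s : ℝ) :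
    1 + (cayleyInv s : ℂ) = 2 * Complex.I / (Complex.I + s) := by
  have h := I_add_ne_zero (z := s) (by simp)
  rw [coe_cayleyInv, cayleyDisc]; field_simp; ring

lemma one_add_cayleyInv_ne_zero (s : ℝ) : 1 + (cayleyInv s : ℂ) ≠ 0 := by
  rw [one_add_cayleyInv]
  exact div_ne_zero (by simp) (I_add_ne_zero (by simp))

lemma one_add_sq_ne_zero (s : ℝ) : (1 + (s : ℂ) ^ 2) ≠ 0 := by
  have : (0 : ℝ) < 1 + s ^ 2 := by positivity
  exact_mod_cast this.ne'

lemma sub_ofReal_ne_zero {z : ℂ} (hz : 0 < z.im) (s : ℝ) : z - s ≠ 0 := by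
  intro h
  have := congrArg Complex.im h
  simp at this
  linarith

/-- The Herglotz kernel in half-plane coordinates. Multiplied by the weight (π(1 + s²))⁻¹ of `psi`,
it becomes the regularized kernel. -/
lemma cayley_kernel_eq {z : ℂ} (hz : 0 < z.im) (s : ℝ) :
    ((cayleyInv s : ℂ) + cayleyDisc z) / (cayleyInv s - cayleyDisc z)
      = Complex.I * (1 + s * z) / (z - s) := by
  have h1 := I_add_ne_zero (z := s) (by simp)
  have h2 := I_add_ne_zero hz.le
  have h3 := sub_ofReal_ne_zero hz s
  have hI : Complex.I ^ 2 = -1 := Complex.I_sq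
  have ha : (cayleyInv s : ℂ) + cayleyDisc z
      = -2 * (1 + s * z) / ((Complex.I + s) * (Complex.I + z)) := by
    rw [coe_cayleyInv, cayleyDisc, cayleyDisc, div_add_div _ _ h1 h2]
    congr 1
    linear_combination 2 * hI
  have hb : (cayleyInv s : ℂ) - cayleyDisc z
      = 2 * Complex.I * (z - s) / ((Complex.I + s) * (Complex.I + z)) := by
    rw [coe_cayleyInv, cayleyDisc, cayleyDisc, div_sub_div _ _ h1 h2]
    congr 1
    ring
  rw [ha, hb, div_div_div_cancel_right₀ (mul_ne_zero h1 h2), div_eq_div_iff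
    (by simp [h3]) h3]
  linear_combination (-2) * (1 + s * z) * (z - s) * hI

/-! ### The regularized Cauchy transform -/

/-- The kernel of the regularized Cauchy transform. -/
noncomputable def regKernel (z : ℂ) (s : ℝ) : ℂ :=
  Complex.I / Real.pi * (1 / (z - s) + s / (1 + (s : ℂ) ^ 2))

lemma regKernel_eq {z : ℂ} {s : ℝ} (h : z - s ≠ 0) :
    regKernel z s = Complex.I / Real.pi * ((1 + s * z) / ((z - s) * (1 + (s : ℂ) ^ 2))) := by
  have := one_add_sq_ne_zero s
  rw [regKernel, div_add_div _ _ h this]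
  congr 2
  ring

lemma measurable_regKernel (z : ℂ) : Measurable (regKernel z) := by
  unfold regKernel
  fun_prop

lemma regKernel_eq_smul {z : ℂ} (hz : 0 < z.im) (s : ℝ) :
    regKernel z s = ((Real.pi * (1 + s ^ 2))⁻¹ : ℝ) •
      (((cayleyInv s : ℂ) + cayleyDisc z) / (cayleyInv s - cayleyDisc z)) := by
  have h1 := one_add_sq_ne_zero s
  have h2 := sub_ofReal_ne_zero hz s
  have h3 : (Real.pi : ℂ) ≠ 0 := by exact_mod_cast Real.pi_ne_zero
  rw [cayley_kernel_eq hz, regKernel_eq h2, Complex.real_smul]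
  push_cast
  field_simp

lemma cauchyReg_eq_cauchyCircle (ν : Measure ℝ) {z : ℂ} (hz : 0 < z.im) :
    cauchyReg ν z = cauchyCircle (psi ν) (cayleyDisc z) := by
  have hm : Measurable fun s : ℝ => ENNReal.ofReal ((Real.pi * (1 + s ^ 2))⁻¹) := by fun_prop
  rw [cauchyCircle_eq, psi, integral_map continuous_cayleyInv.measurable.aemeasurable
    (continuous_cauchyCircle_kernel (norm_cayleyDisc_lt_one hz)).aestronglyMeasurable,
    integral_withDensity_eq_integral_toReal_smul hm (by simp)]
  refine integral_congr_ae (ae_of_all _ fun s => ?_)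
  have : (0 : ℝ) ≤ (Real.pi * (1 + s ^ 2))⁻¹ := by have := Real.pi_pos; positivity
  simp only [ENNReal.toReal_ofReal this]
  exact regKernel_eq_smul hz s

lemma isFiniteMeasure_psi {ν : Measure ℝ} (hν : MemM2 ν) : IsFiniteMeasure (psi ν) := by
  have : IsFiniteMeasure
      (ν.withDensity fun s => ENNReal.ofReal ((Real.pi * (1 + s ^ 2))⁻¹)) := by
    refine isFiniteMeasure_withDensity (ne_of_lt (lt_of_le_of_lt (lintegral_mono fun s => ?_) hν))
    refine ENNReal.ofReal_le_ofReal (inv_anti₀ (by positivity) ?_)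
    nlinarith [Real.pi_gt_three, sq_nonneg s]
  unfold psi
  infer_instance

lemma MemM2.integrable {ν : Measure ℝ} (hν : MemM2 ν) :
    Integrable (fun s : ℝ => (1 + s ^ 2)⁻¹) ν := by
  refine ⟨Measurable.aestronglyMeasurable (by fun_prop), ?_⟩
  rw [hasFiniteIntegral_iff_ofReal (ae_of_all _ fun s => by positivity)]
  exact hν

lemma norm_sub_ofReal_ge_im {z : ℂ} (s : ℝ) : z.im ≤ ‖z - s‖ := by
  have := Complex.abs_im_le_norm (z - s)
  simp at this
  exact (le_abs_self _).trans this

/-- The splitting 1 + sz = (1 + z²) − z(z − s) isolates the singularity. The bound serves for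
integrability at fixed z and for domination as z approaches the real line or infinity. -/
lemma norm_regKernel_le {z : ℂ} {s : ℝ} (hz : z - s ≠ 0) :
    ‖regKernel z s‖ ≤ (‖1 + z ^ 2‖ / ‖z - s‖ + ‖z‖) * (1 + s ^ 2)⁻¹ := by
  have h1 : ‖(1 : ℂ) + s ^ 2‖ = 1 + s ^ 2 := by
    have : (0 : ℝ) ≤ 1 + s ^ 2 := by positivity
    rw [show (1 : ℂ) + s ^ 2 = ((1 + s ^ 2 : ℝ) : ℂ) by push_cast; ring, Complex.norm_real,
      Real.norm_of_nonneg this]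
  have h0 : 0 < ‖z - s‖ := norm_pos_iff.2 hz
  have h2 : ‖1 + s * z‖ ≤ ‖1 + z ^ 2‖ + ‖z‖ * ‖z - s‖ := by
    rw [show 1 + s * z = (1 + z ^ 2) - z * (z - s) by ring, ← norm_mul]
    exact norm_sub_le _ _
  have h3 : ‖Complex.I / (Real.pi : ℂ)‖ ≤ 1 := by
    rw [norm_div, Complex.norm_I, Complex.norm_real, Real.norm_of_nonneg Real.pi_pos.le,
      div_le_one Real.pi_pos]
    linarith [Real.pi_gt_three]
  rw [regKernel_eq hz, norm_mul, norm_div (1 + s * z), norm_mul (z - s), h1]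
  calc _ ≤ 1 * (‖1 + s * z‖ / (‖z - s‖ * (1 + s ^ 2))) := by gcongr
    _ ≤ 1 * ((‖1 + z ^ 2‖ + ‖z‖ * ‖z - s‖) / (‖z - s‖ * (1 + s ^ 2))) := by gcongr
    _ = _ := by field_simp

lemma integrable_regKernel {ν : Measure ℝ} (hν : MemM2 ν) {z : ℂ} (hz : 0 < z.im) :
    Integrable (regKernel z) ν := by
  refine (hν.integrable.const_mul (‖1 + z ^ 2‖ / z.im + ‖z‖)).mono'
    (measurable_regKernel z).aestronglyMeasurable (ae_of_all _ fun s => ?_)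
  refine (norm_regKernel_le (sub_ofReal_ne_zero hz s)).trans ?_
  gcongr
  exact norm_sub_ofReal_ge_im s

lemma re_regKernel {z : ℂ} (s : ℝ) :
    (regKernel z s).re = Real.pi⁻¹ * (z.im / ‖z - s‖ ^ 2) := by
  rw [show regKernel z s = Complex.I * ((Real.pi⁻¹ : ℝ) *
    ((z - s)⁻¹ + ((s / (1 + s ^ 2) : ℝ) : ℂ))) by rw [regKernel]; push_cast; ring,
    Complex.I_mul_re, Complex.im_ofReal_mul, Complex.add_im, Complex.inv_im, Complex.ofReal_im,
    Complex.normSq_eq_norm_sq]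
  simp
  ring

/-- The Poisson integral `∫ y / |z - s|² dν(s)`, `y = Im z`. -/
noncomputable def poissonInt (ν : Measure ℝ) (z : ℂ) : ENNReal :=
  ∫⁻ s : ℝ, ENNReal.ofReal (z.im / ‖z - s‖ ^ 2) ∂ν

lemma measurable_poissonKernel (z : ℂ) :
    Measurable fun s : ℝ => ENNReal.ofReal (z.im / ‖z - s‖ ^ 2) := by fun_prop

lemma integrable_poissonKernel {ν : Measure ℝ} (hν : MemM2 ν) {z : ℂ} (hz : 0 < z.im) :
    Integrable (fun s : ℝ => z.im / ‖z - s‖ ^ 2) ν := by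
  have h := (integrable_regKernel hν hz).re.const_mul Real.pi
  refine h.congr (ae_of_all _ fun s => ?_)
  simp only [RCLike.re_to_complex, re_regKernel]
  field_simp [Real.pi_ne_zero]

lemma poissonInt_lt_top {ν : Measure ℝ} (hν : MemM2 ν) {z : ℂ} (hz : 0 < z.im) :
    poissonInt ν z < ⊤ := by
  have h := (integrable_poissonKernel hν hz).hasFiniteIntegral
  rwa [hasFiniteIntegral_iff_ofReal (ae_of_all _ fun s => by positivity)] at h

lemma re_cauchyReg {ν : Measure ℝ} (hν : MemM2 ν) {z : ℂ} (hz : 0 < z.im) :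
    (cauchyReg ν z).re = Real.pi⁻¹ * (poissonInt ν z).toReal := by
  have h1 : (cauchyReg ν z).re = ∫ s, (regKernel z s).re ∂ν :=
    (integral_re (integrable_regKernel hν hz)).symm
  simp only [re_regKernel] at h1
  rw [h1, integral_const_mul, integral_eq_lintegral_of_nonneg_ae
    (ae_of_all _ fun s => by positivity) (integrable_poissonKernel hν hz).aestronglyMeasurable]
  rfl

lemma poissonInt_pos {ν : Measure ℝ} (hν : ν ≠ 0) {z : ℂ} (hz : 0 < z.im) :
    0 < poissonInt ν z := by
  rw [poissonInt, pos_iff_ne_zero, Ne, lintegral_eq_zero_iff (measurable_poissonKernel z)]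
  intro h
  apply hν
  rw [← ae_eq_bot, ← Filter.empty_mem_iff_bot]
  refine mem_of_superset h fun s hs => ?_
  have h0 := norm_pos_iff.2 (sub_ofReal_ne_zero hz s)
  have : 0 < z.im / ‖z - s‖ ^ 2 := by positivity
  simp only [Set.mem_ofPred_eq, Pi.zero_apply, ENNReal.ofReal_eq_zero] at hs
  exact absurd hs (not_le.2 this)

lemma differentiableOn_cauchyReg {ν : Measure ℝ} (hν : MemM2 ν) :
    DifferentiableOn ℂ (cauchyReg ν) {z | 0 < z.im} := by
  have := isFiniteMeasure_psi hν
  refine DifferentiableOn.congr (f := fun z => cauchyCircle (psi ν) (cayleyDisc z)) ?_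
    fun z hz => cauchyReg_eq_cauchyCircle ν hz
  refine (differentiableOn_cauchyCircle (psi ν)).comp ?_
    fun z hz => by simpa using norm_cayleyDisc_lt_one hz
  intro z hz
  refine DifferentiableAt.differentiableWithinAt ?_
  unfold cayleyDisc
  exact DifferentiableAt.div (by fun_prop) (by fun_prop) (I_add_ne_zero (le_of_lt hz))

/-! ### Nevanlinna representation -/

/-- `Q_reg[ν](z) - iπ⁻¹(a + b z)`. -/
noncomputable def nevanlinna (ν : Measure ℝ) (a b : ℝ) (z : ℂ) : ℂ :=
  cauchyReg ν z - Complex.I * (Real.pi : ℂ)⁻¹ * (a + b * z)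

lemma re_nevanlinna {ν : Measure ℝ} (hν : MemM2 ν) (a b : ℝ) {z : ℂ} (hz : 0 < z.im) :
    (nevanlinna ν a b z).re = Real.pi⁻¹ * ((poissonInt ν z).toReal + b * z.im) := by
  rw [nevanlinna, Complex.sub_re, re_cauchyReg hν hz, mul_assoc, Complex.I_mul_re,
    ← Complex.ofReal_inv, Complex.im_ofReal_mul]
  simp
  ring

lemma differentiableOn_nevanlinna {ν : Measure ℝ} (hν : MemM2 ν) (a b : ℝ) :
    DifferentiableOn ℂ (nevanlinna ν a b) {z | 0 < z.im} :=
  (differentiableOn_cauchyReg hν).sub (by fun_prop)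

/-- The kernel at −1 equals (1 − ω)/(1 + ω) = −iz for z = `cayleyPlane ω`, so the atom at −1 is
exactly the linear term in z. -/
lemma cauchyCircle_psiReg {ν : Measure ℝ} (hν : MemM2 ν) (a : ℝ) {b : ℝ} (hb : 0 ≤ b) {ω : ℂ}
    (hω : ‖ω‖ < 1) :
    cauchyCircle (psiReg ν a b).1 ω = nevanlinna ν a b (cayleyPlane ω)
      + Complex.I * (Real.pi⁻¹ * a : ℝ) := by
  have := isFiniteMeasure_psi hν
  have h1 := one_add_ne_zero_of_norm_lt hω
  have hpi := Real.pi_pos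
  rw [nevanlinna, cauchyReg_eq_cauchyCircle ν (im_cayleyPlane_pos hω), cayleyDisc_cayleyPlane h1]
  have hk := integrable_cauchyCircle_kernel (psi ν) hω
  simp only [psiReg, cauchyCircle_eq]
  rw [integral_add_measure hk ((integrable_cauchyCircle_kernel _ hω).smul_measure (by simp)),
    integral_smul_measure, integral_dirac, ENNReal.toReal_ofReal (by positivity),
    Complex.real_smul, cayleyPlane, Circle.coe_neg, Circle.coe_one]
  have h2 : -1 - ω ≠ 0 := fun h => h1 (by linear_combination -h)
  have h3 : (Real.pi : ℂ) ≠ 0 := by exact_mod_cast hpi.ne'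
  push_cast
  rw [show (-1 + ω) / (-1 - ω) = (1 - ω) / (1 + ω) by field_simp; ring]
  have hI : Complex.I ^ 2 = -1 := Complex.I_sq
  field_simp
  linear_combination ((b : ℂ) * (1 - ω)) * hI

lemma measurable_circle_coe : Measurable fun w : Circle => (w : ℂ) :=
  (by fun_prop : Continuous fun w : Circle => (w : ℂ)).measurable

/-- Holomorphic functions on the upper half-plane with non-negative real part. -/
theorem exists_nevanlinna_eq {G : ℂ → ℂ} (hG : DifferentiableOn ℂ G {z | 0 < z.im})
    (hG0 : ∀ z : ℂ, 0 < z.im → 0 ≤ (G z).re) :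
    ∃ (μ : Measure ℝ) (a b : ℝ), MemM2 μ ∧ 0 ≤ b ∧ ∀ z : ℂ, 0 < z.im → G z = nevanlinna μ a b z := by
  obtain ⟨ν, c, hfin, hν⟩ := exists_cauchyCircle_eq (G := fun ω => G (cayleyPlane ω))
    (by
      refine hG.comp ?_ fun ω hω => im_cayleyPlane_pos (by simpa using hω)
      intro ω hω
      refine DifferentiableAt.differentiableWithinAt ?_
      unfold cayleyPlane
      exact DifferentiableAt.div (by fun_prop) (by fun_prop)
        (one_add_ne_zero_of_norm_lt (by simpa using hω)))
    (fun ω hω => hG0 _ (im_cayleyPlane_pos (by simpa using hω)))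
  have hpi := Real.pi_pos
  have hpi' : (Real.pi : ℂ) ≠ 0 := by exact_mod_cast hpi.ne'
  -- Inverse of `cayleyInv` away from −1. Its value at −1 is a default, so that atom is split off
  -- and becomes the coefficient of z.
  let p : Circle → ℝ := fun w => (cayleyPlane w).re
  have hp : Measurable p := by
    have := measurable_circle_coe
    simp only [p, cayleyPlane]
    fun_prop
  have hpw : ∀ w : Circle, w ≠ -1 → cayleyInv (p w) = w := by
    intro w hw
    have h1 : 1 + (w : ℂ) ≠ 0 := fun h => hw (Circle.ext (by
      rw [Circle.coe_neg, Circle.coe_one]; linear_combination h))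
    have h2 : ((p w : ℝ) : ℂ) = cayleyPlane w := by
      apply Complex.ext
      · simp [p]
      · rw [im_cayleyPlane, Circle.norm_coe]; simp
    refine Circle.ext ?_
    rw [coe_cayleyInv, h2, cayleyDisc_cayleyPlane h1]
  have hdm : Measurable fun s : ℝ => ENNReal.ofReal (Real.pi * (1 + s ^ 2)) := by fun_prop
  let κ : Measure ℝ := (ν.restrict {-1}ᶜ).map p
  -- The density π(1 + s²) undoes the weight in `psi`; the factors π in the constants cancel the π⁻¹
  -- in `nevanlinna`.
  refine ⟨κ.withDensity fun s => ENNReal.ofReal (Real.pi * (1 + s ^ 2)), -(Real.pi * c),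
    Real.pi * ν.real {-1}, ?_, by positivity, fun z hz => ?_⟩
  · have : ∀ s : ℝ, ENNReal.ofReal (Real.pi * (1 + s ^ 2)) * ENNReal.ofReal ((1 + s ^ 2)⁻¹)
        = ENNReal.ofReal Real.pi := fun s => by
      rw [← ENNReal.ofReal_mul (by positivity), mul_assoc, mul_inv_cancel₀ (by positivity), mul_one]
    rw [MemM2, lintegral_withDensity_eq_lintegral_mul _ hdm (by fun_prop)]
    simp only [Pi.mul_apply, this, lintegral_const]
    have : IsFiniteMeasure κ := by simp only [κ]; infer_instance
    exact ENNReal.mul_lt_top ENNReal.ofReal_lt_top (measure_lt_top _ _)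
  · have hω := norm_cayleyDisc_lt_one hz
    have h1 := hν (cayleyDisc z) (by simpa using hω)
    simp only [cayleyPlane_cayleyDisc hz.le] at h1
    have hcR : cauchyReg (κ.withDensity fun s => ENNReal.ofReal (Real.pi * (1 + s ^ 2))) z
        = ∫ w in {-1}ᶜ, ((w : ℂ) + cayleyDisc z) / (w - cayleyDisc z) ∂ν := by
      change ∫ s, regKernel z s ∂_ = _
      rw [integral_withDensity_eq_integral_toReal_smul hdm (by simp),
        integral_map hp.aemeasurable (f := fun s : ℝ =>
          (ENNReal.ofReal (Real.pi * (1 + s ^ 2))).toReal • regKernel z s)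
          (hdm.ennreal_toReal.smul (measurable_regKernel z)).aestronglyMeasurable]
      refine setIntegral_congr_fun (measurableSet_singleton _).compl fun w hw => ?_
      have hs : (0 : ℝ) < 1 + p w ^ 2 := by positivity
      simp only [ENNReal.toReal_ofReal (by positivity : (0 : ℝ) ≤ Real.pi * (1 + p w ^ 2))]
      rw [regKernel_eq_smul hz, hpw w hw, smul_smul, mul_inv_cancel₀ (by positivity), one_smul]
    have hk := integrable_cauchyCircle_kernel ν hω
    have h2 := integral_add_compl (measurableSet_singleton (-1 : Circle)) hk
    rw [integral_singleton, ← hcR] at h2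
    rw [h1, cauchyCircle_eq, ← h2, nevanlinna, Complex.real_smul, Circle.coe_neg, Circle.coe_one]
    have h3 : (-1 + cayleyDisc z) / (-1 - cayleyDisc z) = -Complex.I * z := by
      have h4 := one_add_ne_zero_of_norm_lt hω
      have h5 : -1 - cayleyDisc z ≠ 0 := fun h => h4 (by linear_combination -h)
      conv_rhs => rw [← cayleyPlane_cayleyDisc hz.le, cayleyPlane]
      have hI : Complex.I ^ 2 = -1 := Complex.I_sq
      rw [show (-1 + cayleyDisc z) / (-1 - cayleyDisc z) = (1 - cayleyDisc z) / (1 + cayleyDisc z)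
        by field_simp; ring]
      field_simp
      linear_combination ((1 - cayleyDisc z)) * hI
    rw [h3]
    push_cast
    field_simp
    ring

/-! ### Nontangential approach to the real line -/

/-- Nontangential approach to a real point from the upper half-plane. -/
noncomputable def coneFilter (s : ℝ) : Filter ℂ :=
  nhdsWithin (s : ℂ) {z : ℂ | 0 < z.im ∧ ‖z - s‖ ≤ 2 * z.im}

lemma eventually_cone (s : ℝ) :
    ∀ᶠ z : ℂ in coneFilter s, 0 < z.im ∧ ‖z - s‖ ≤ 2 * z.im :=
  self_mem_nhdsWithin

lemma coneFilter_le_nhds (s : ℝ) : coneFilter s ≤ 𝓝 (s : ℂ) := nhdsWithin_le_nhds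

lemma tendsto_im_coneFilter (s : ℝ) : Tendsto Complex.im (coneFilter s) (𝓝[>] 0) := by
  refine tendsto_nhdsWithin_iff.2 ⟨?_, (eventually_cone s).mono fun z hz => hz.1⟩
  have := (Complex.continuous_im.tendsto (s : ℂ)).mono_left (coneFilter_le_nhds s)
  simpa using this

lemma tendsto_vertical_coneFilter (s : ℝ) :
    Tendsto (fun δ : ℝ => (s : ℂ) + δ * Complex.I) (𝓝[>] 0) (coneFilter s) := by
  refine tendsto_nhdsWithin_iff.2 ⟨?_, ?_⟩
  · have : Continuous fun δ : ℝ => (s : ℂ) + δ * Complex.I := by fun_prop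
    simpa using (this.tendsto 0).mono_left nhdsWithin_le_nhds
  · filter_upwards [self_mem_nhdsWithin] with δ hδ
    have hδ' : 0 < δ := hδ
    refine ⟨by simpa using hδ', ?_⟩
    simp [abs_of_pos hδ']
    linarith

instance coneFilter_neBot (s : ℝ) : (coneFilter s).NeBot :=
  (tendsto_vertical_coneFilter s).neBot

/-- A radius meets the circle at a right angle and the Cayley map is conformal, so its image ends
inside the cone. Nontangential limits thus give the radial limits that define `HasHilbertReg`. -/
lemma tendsto_radial_coneFilter (s : ℝ) :
    Tendsto (fun r : ℝ => cayleyPlane (r * (cayleyInv s : ℂ))) (𝓝[<] 1) (coneFilter s) := by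
  set w : ℂ := (cayleyInv s : ℂ) with hw
  have hw1 : ‖w‖ = 1 := Circle.norm_coe _
  have hne : 1 + w ≠ 0 := one_add_cayleyInv_ne_zero s
  have hs : cayleyPlane w = s := by
    rw [hw, coe_cayleyInv, cayleyPlane_cayleyDisc (by simp)]
  have hcont : Tendsto (fun r : ℝ => 1 + (r : ℂ) * w) (𝓝[<] 1) (𝓝 (1 + w)) := by
    have : Continuous fun r : ℝ => 1 + (r : ℂ) * w := by fun_prop
    simpa using (this.tendsto 1).mono_left nhdsWithin_le_nhds
  have hpos : 0 < ‖1 + w‖ := norm_pos_iff.2 hne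
  refine tendsto_nhdsWithin_iff.2 ⟨?_, ?_⟩
  · have h2 : Tendsto (fun r : ℝ => 1 - (r : ℂ) * w) (𝓝[<] 1) (𝓝 (1 - w)) := by
      have : Continuous fun r : ℝ => 1 - (r : ℂ) * w := by fun_prop
      simpa using (this.tendsto 1).mono_left nhdsWithin_le_nhds
    rw [← hs]
    exact (h2.const_mul Complex.I).div hcont hne
  · have hev : ∀ᶠ r : ℝ in 𝓝[<] 1, ‖1 + (r : ℂ) * w‖ < 3 / 2 * ‖1 + w‖ :=
      hcont.norm.eventually (gt_mem_nhds (by linarith))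
    filter_upwards [hev, Ioo_mem_nhdsLT (show (1 / 2 : ℝ) < 1 by norm_num)] with r hr1 hr
    have hrw : ‖(r : ℂ) * w‖ = r := by
      rw [norm_mul, hw1, mul_one, Complex.norm_real, Real.norm_of_nonneg (by linarith [hr.1])]
    have hne' := one_add_ne_zero_of_norm_lt (hrw.trans_lt hr.2)
    have hpos' : 0 < ‖1 + (r : ℂ) * w‖ := norm_pos_iff.2 hne'
    refine ⟨im_cayleyPlane_pos (hrw.trans_lt hr.2), ?_⟩
    have h3 : cayleyPlane (r * w) - s
        = 2 * Complex.I * w * ((1 - r : ℝ) : ℂ) / ((1 + r * w) * (1 + w)) := by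
      rw [← hs, cayleyPlane, cayleyPlane, div_sub_div _ _ hne' hne]
      congr 1
      push_cast
      ring
    rw [h3, im_cayleyPlane, hrw, norm_div, norm_mul, norm_mul, norm_mul, norm_mul, hw1,
      Complex.norm_real, Real.norm_of_nonneg (by linarith [hr.2]), Complex.norm_I,
      Complex.norm_two, ← mul_div_assoc, div_le_div_iff₀ (by positivity) (by positivity)]
    have h4 : 0 < 1 - r := by linarith [hr.2]
    have h5 : ‖1 + (r : ℂ) * w‖ ≤ (1 + r) * ‖1 + w‖ := by nlinarith [hr.1]
    have h6 : 0 ≤ 2 * (1 - r) * ‖1 + (r : ℂ) * w‖ := by positivity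
    nlinarith [mul_le_mul_of_nonneg_left h5 h6]

lemma cone_abs_sub_le {s : ℝ} {z : ℂ} (hz : ‖z - s‖ ≤ 2 * z.im) (t : ℝ) :
    |t - s| ≤ 3 * ‖z - t‖ := by
  have h1 := norm_sub_ofReal_ge_im (z := z) t
  have h2 : ‖((t - s : ℝ) : ℂ)‖ ≤ ‖z - s‖ + ‖z - t‖ := by
    rw [show ((t - s : ℝ) : ℂ) = (z - s) - (z - t) by push_cast; ring]
    exact norm_sub_le _ _
  rw [Complex.norm_real, Real.norm_eq_abs] at h2
  linarith

/-! ### Fatou's theorem for Poisson integrals -/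

/-- `σ` has density zero at `s` with respect to Lebesgue measure. -/
def HasDensityZero (σ : Measure ℝ) (s : ℝ) : Prop :=
  Tendsto (fun r => σ (Metric.closedBall s r) / volume (Metric.closedBall s r)) (𝓝[>] 0) (𝓝 0)

/-- Dyadic decomposition: on the shell |t − s| ≈ 2ᵏy the kernel is at most 36·4⁻ᵏ/y, while the ball
has mass at most ε2ᵏy. The sum of 36ε2⁻ᵏ is 72ε. -/
lemma lintegral_poissonKernel_closedBall_le {σ : Measure ℝ} {s η : ℝ} {ε : ENNReal}
    (h : ∀ r, 0 < r → r ≤ η → σ (Metric.closedBall s r) ≤ ε * ENNReal.ofReal r) {z : ℂ}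
    (hz0 : 0 < z.im) (hz : ‖z - s‖ ≤ 2 * z.im) (hη : 0 < η) :
    ∫⁻ t in Metric.closedBall s η, ENNReal.ofReal (z.im / ‖z - t‖ ^ 2) ∂σ ≤ 72 * ε := by
  set y := z.im with hy
  -- Radii are cut at η because the growth bound is only available up to η.
  let B : ℕ → Set ℝ := fun k => Metric.closedBall s (min (2 ^ k * y) η)
  let a : ℕ → ENNReal := fun k => ENNReal.ofReal (36 * (1 / 4) ^ k / y)
  have hpt : ∀ t ∈ Metric.closedBall s η, ENNReal.ofReal (y / ‖z - t‖ ^ 2)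
      ≤ ∑' k, (B k).indicator (fun _ => a k) t := by
    intro t ht
    have ht' : |t - s| ≤ η := by simpa [Real.dist_eq] using ht
    have hex : ∃ k : ℕ, |t - s| ≤ 2 ^ k * y := by
      obtain ⟨k, hk⟩ := pow_unbounded_of_one_lt (|t - s| / y) (one_lt_two : (1 : ℝ) < 2)
      exact ⟨k, by rw [div_lt_iff₀ hz0] at hk; exact hk.le⟩
    classical
    set k := Nat.find hex with hk
    have hk1 : |t - s| ≤ 2 ^ k * y := Nat.find_spec hex
    refine le_trans ?_ (ENNReal.le_tsum k)
    have htB : t ∈ B k := by simpa [B, Real.dist_eq] using ⟨hk1, ht'⟩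
    rw [Set.indicator_of_mem htB]
    refine ENNReal.ofReal_le_ofReal ?_
    have hn1 : y ≤ ‖z - t‖ := norm_sub_ofReal_ge_im t
    have hn2 := cone_abs_sub_le hz t
    -- For k = 0 this is y ≤ ‖z − t‖. For k > 0 minimality of k gives 2ᵏ⁻¹y < |t − s| ≤ 3‖z − t‖.
    -- Squaring 6 yields the constant 36.
    have hkey : y * 2 ^ k ≤ 6 * ‖z - t‖ := by
      rcases Nat.eq_zero_or_pos k with h0 | h0
      · rw [h0]; linarith
      · have := Nat.find_min hex (m := k - 1) (by omega)
        rw [not_le] at this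
        have h2 : (2 : ℝ) ^ k = 2 * 2 ^ (k - 1) := by
          rw [← pow_succ']; congr 1; omega
        rw [h2]
        linarith
    have hn0 : 0 < ‖z - t‖ := hz0.trans_le hn1
    have h4 : (1 / 4 : ℝ) ^ k = 1 / (2 ^ k) ^ 2 := by
      rw [← pow_mul, mul_comm k 2, pow_mul, one_div_pow]; norm_num
    rw [h4, mul_one_div, div_div, div_le_div_iff₀ (by positivity) (by positivity)]
    have h5 : 0 < y * 2 ^ k := by positivity
    nlinarith [mul_self_le_mul_self h5.le hkey]
  have hBm : ∀ k, MeasurableSet (B k) := fun k => Metric.isClosed_closedBall.measurableSet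
  have hgeom : ∑' k : ℕ, (2⁻¹ : ENNReal) ^ k = 2 := by
    rw [ENNReal.tsum_geometric, ENNReal.one_sub_inv_two, inv_inv]
  calc ∫⁻ t in Metric.closedBall s η, ENNReal.ofReal (y / ‖z - t‖ ^ 2) ∂σ
      ≤ ∫⁻ t in Metric.closedBall s η, ∑' k, (B k).indicator (fun _ => a k) t ∂σ :=
        setLIntegral_mono' Metric.isClosed_closedBall.measurableSet hpt
    _ ≤ ∫⁻ t, ∑' k, (B k).indicator (fun _ => a k) t ∂σ := setLIntegral_le_lintegral _ _
    _ = ∑' k, a k * σ (B k) := by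
        rw [lintegral_tsum fun k => (measurable_const.indicator (hBm k)).aemeasurable]
        simp_rw [lintegral_indicator_const (hBm _)]
    _ ≤ ∑' k : ℕ, 36 * ε * 2⁻¹ ^ k := by
        refine ENNReal.tsum_le_tsum fun k => ?_
        have h1 : σ (B k) ≤ ε * ENNReal.ofReal (2 ^ k * y) :=
          (h _ (by positivity) (min_le_right _ _)).trans
            (by gcongr; exact min_le_left _ _)
        refine (mul_le_mul_right h1 (a k)).trans (le_of_eq ?_)
        have h2 : (2⁻¹ : ENNReal) ^ k = ENNReal.ofReal ((1 / 2) ^ k) := by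
          rw [ENNReal.ofReal_pow (by norm_num), one_div, ENNReal.ofReal_inv_of_pos two_pos,
            ENNReal.ofReal_ofNat]
        have h3 : (36 : ENNReal) = ENNReal.ofReal 36 := by norm_num
        rw [h2, h3, mul_comm (ENNReal.ofReal 36) ε, mul_assoc,
          ← ENNReal.ofReal_mul (by norm_num), mul_left_comm,
          ← ENNReal.ofReal_mul (by positivity)]
        congr 2
        have : (1 / 4 : ℝ) ^ k * 2 ^ k = (1 / 2) ^ k := by rw [← mul_pow]; norm_num
        rw [← this]
        field_simp
    _ = 72 * ε := by
        rw [ENNReal.tsum_mul_left, hgeom]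
        ring_nf

/-- Away from s the kernel is O(Im z) times (1 + t²)⁻¹, so this part vanishes in the limit. The
constants come from |t − s| ≤ 3‖z − t‖ and 1 + t² ≤ 1 + 2s² + 2(t − s)². -/
lemma setLIntegral_poissonKernel_compl_le {σ : Measure ℝ} {s η : ℝ} (hη : 0 < η) {z : ℂ}
    (hz0 : 0 < z.im) (hz : ‖z - s‖ ≤ 2 * z.im) :
    ∫⁻ t in (Metric.closedBall s η)ᶜ, ENNReal.ofReal (z.im / ‖z - t‖ ^ 2) ∂σ
      ≤ ENNReal.ofReal (z.im * (9 * ((1 + 2 * s ^ 2) / η ^ 2 + 2)))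
        * ∫⁻ t, ENNReal.ofReal ((1 + t ^ 2)⁻¹) ∂σ := by
  rw [← lintegral_const_mul _ (by fun_prop)]
  refine le_trans (setLIntegral_mono' Metric.isClosed_closedBall.measurableSet.compl
    fun t ht => ?_) (setLIntegral_le_lintegral _ _)
  have ht' : η < |t - s| := by simpa [Real.dist_eq] using ht
  rw [← ENNReal.ofReal_mul (by positivity)]
  refine ENNReal.ofReal_le_ofReal ?_
  have hn2 := cone_abs_sub_le hz t
  have hn0 : 0 < ‖z - t‖ := norm_pos_iff.2 (sub_ofReal_ne_zero hz0 t)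
  rw [div_eq_mul_inv, mul_assoc]
  gcongr
  rw [← div_eq_mul_inv, inv_eq_one_div, div_le_div_iff₀ (by positivity) (by positivity), one_mul]
  have h1 : (t - s) ^ 2 ≤ 9 * ‖z - t‖ ^ 2 := by
    rw [← sq_abs (t - s)]; nlinarith [abs_nonneg (t - s)]
  have h2 : η ^ 2 ≤ (t - s) ^ 2 := by
    rw [← sq_abs (t - s)]; nlinarith
  have h3 : 1 + 2 * s ^ 2 ≤ (1 + 2 * s ^ 2) / η ^ 2 * (t - s) ^ 2 := by
    rw [div_mul_eq_mul_div, le_div_iff₀ (by positivity)]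
    gcongr
  have h4 : 1 + t ^ 2 ≤ ((1 + 2 * s ^ 2) / η ^ 2 + 2) * (t - s) ^ 2 := by
    nlinarith [sq_nonneg (t - 2 * s)]
  have h5 : 0 ≤ (1 + 2 * s ^ 2) / η ^ 2 + 2 := by positivity
  nlinarith [mul_le_mul_of_nonneg_left h1 h5]

lemma tendsto_poissonInt_of_hasDensityZero {σ : Measure ℝ} (hσ : MemM2 σ) {s : ℝ}
    (h : HasDensityZero σ s) : Tendsto (poissonInt σ) (coneFilter s) (𝓝 0) := by
  rw [ENNReal.tendsto_nhds_zero]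
  intro ε hε
  rcases eq_or_ne ε ⊤ with rfl | hεt
  · simp
  -- Half of ε is kept for the tail; 144 = 72·2, the 2 coming from the length 2r of the ball.
  have hε' : 0 < ε / 2 / 144 := by simp [hε.ne']
  obtain ⟨η, hη, hηs⟩ := mem_nhdsGT_iff_exists_Ioc_subset.1
    ((ENNReal.tendsto_nhds_zero.1 h) _ hε')
  have hη0 : 0 < η := hη
  have hball : ∀ r, 0 < r → r ≤ η → σ (Metric.closedBall s r) ≤ ε / 2 / 72 * ENNReal.ofReal r := by
    intro r hr hrη
    have h1 : σ (Metric.closedBall s r) / volume (Metric.closedBall s r) ≤ ε / 2 / 144 :=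
      hηs ⟨hr, hrη⟩
    rw [Real.volume_closedBall, ENNReal.div_le_iff (by simp [hr]) ENNReal.ofReal_ne_top] at h1
    refine h1.trans (le_of_eq ?_)
    rw [ENNReal.ofReal_mul two_pos.le, ENNReal.ofReal_ofNat, ← mul_assoc]
    congr 1
    rw [show (144 : ENNReal) = 72 * 2 by norm_num, div_eq_mul_inv (ε / 2) (72 * 2),
      ENNReal.mul_inv (by simp) (by simp), mul_assoc, mul_assoc,
      ENNReal.inv_mul_cancel (by simp) (by simp), mul_one, div_eq_mul_inv (ε / 2) 72]
  have htail : Tendsto (fun z : ℂ => ENNReal.ofReal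
      (z.im * (9 * ((1 + 2 * s ^ 2) / η ^ 2 + 2))) * ∫⁻ t, ENNReal.ofReal ((1 + t ^ 2)⁻¹) ∂σ)
      (coneFilter s) (𝓝 0) := by
    have h1 := ((tendsto_im_coneFilter s).mono_right nhdsWithin_le_nhds).mul_const
      (9 * ((1 + 2 * s ^ 2) / η ^ 2 + 2))
    have h2 := ENNReal.Tendsto.mul_const (ENNReal.tendsto_ofReal h1)
      (Or.inr hσ.ne : _ ∨ (∫⁻ t, ENNReal.ofReal ((1 + t ^ 2)⁻¹) ∂σ) ≠ ⊤)
    simpa using h2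
  filter_upwards [eventually_cone s, (ENNReal.tendsto_nhds_zero.1 htail) (ε / 2)
    (by simp [hε.ne'])] with z hz hz2
  rw [poissonInt, ← lintegral_add_compl _ (Metric.isClosed_closedBall (x := s) (ε := η)).measurableSet]
  refine (add_le_add (lintegral_poissonKernel_closedBall_le hball hz.1 hz.2 hη0)
    ((setLIntegral_poissonKernel_compl_le hη0 hz.1 hz.2).trans hz2)).trans (le_of_eq ?_)
  rw [ENNReal.mul_div_cancel (by simp) (by simp), ENNReal.add_halves]

lemma poissonInt_volume {z : ℂ} (hz : 0 < z.im) :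
    poissonInt volume z = ENNReal.ofReal Real.pi := by
  have hpi := Real.pi_pos
  have h := ProbabilityTheory.lintegral_cauchyPDF_eq_one z.re (γ := z.im.toNNReal)
    (Real.toNNReal_pos.2 hz).ne'
  have h2 : ∀ t : ℝ, ENNReal.ofReal (z.im / ‖z - t‖ ^ 2)
      = ENNReal.ofReal Real.pi * ProbabilityTheory.cauchyPDF z.re z.im.toNNReal t := by
    intro t
    rw [ProbabilityTheory.cauchyPDF_def, ProbabilityTheory.cauchyPDFReal_def,
      ← ENNReal.ofReal_mul hpi.le, ← Complex.normSq_eq_norm_sq, Complex.normSq_apply]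
    congr 1
    simp only [Real.coe_toNNReal _ hz.le, Complex.sub_re, Complex.sub_im, Complex.ofReal_re, Complex.ofReal_im,
      sub_zero]
    field_simp
    ring
  simp only [poissonInt, h2]
  rw [lintegral_const_mul _ (ProbabilityTheory.measurable_cauchyPDF _ _), h, mul_one]

lemma poissonInt_mono {μ ν : Measure ℝ} (h : μ ≤ ν) (z : ℂ) : poissonInt μ z ≤ poissonInt ν z :=
  lintegral_mono' h le_rfl

lemma poissonInt_add (μ ν : Measure ℝ) (z : ℂ) :
    poissonInt (μ + ν) z = poissonInt μ z + poissonInt ν z := lintegral_add_measure _ _ _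

lemma poissonInt_smul (c : ENNReal) (ν : Measure ℝ) (z : ℂ) :
    poissonInt (c • ν) z = c * poissonInt ν z := lintegral_smul_measure _ _

/-- The Poisson integral of Lebesgue measure is constantly π and that of σ tends to 0. Two
inequalities between positive measures replace a bound on the signed measure ν − c dt. -/
lemma tendsto_poissonInt_of_le {ν σ : Measure ℝ} (hσ : MemM2 σ) {s : ℝ} (h : HasDensityZero σ s)
    {c : ENNReal} (hc : c ≠ ⊤) (h1 : ν ≤ c • volume + σ) (h2 : c • volume ≤ ν + σ) :
    Tendsto (poissonInt ν) (coneFilter s) (𝓝 (c * ENNReal.ofReal Real.pi)) := by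
  have hσ0 := tendsto_poissonInt_of_hasDensityZero hσ h
  have hne : c * ENNReal.ofReal Real.pi ≠ ⊤ := ENNReal.mul_ne_top hc (by simp)
  have hu : Tendsto (fun z => c * ENNReal.ofReal Real.pi + poissonInt σ z) (coneFilter s)
      (𝓝 (c * ENNReal.ofReal Real.pi)) := by simpa using tendsto_const_nhds.add hσ0
  have hl : Tendsto (fun z => c * ENNReal.ofReal Real.pi - poissonInt σ z) (coneFilter s)
      (𝓝 (c * ENNReal.ofReal Real.pi)) := by
    simpa using ENNReal.Tendsto.sub tendsto_const_nhds hσ0 (Or.inl hne)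
  refine tendsto_of_tendsto_of_tendsto_of_le_of_le' hl hu ?_ ?_
  · filter_upwards [eventually_cone s] with z hz
    rw [tsub_le_iff_right, ← poissonInt_volume hz.1, ← poissonInt_smul, ← poissonInt_add]
    exact poissonInt_mono h2 z
  · filter_upwards [eventually_cone s] with z hz
    rw [← poissonInt_volume hz.1, ← poissonInt_smul, ← poissonInt_add]
    exact poissonInt_mono h1 z

lemma MemM2.mono {μ ν : Measure ℝ} (hν : MemM2 ν) (h : μ ≤ ν) : MemM2 μ :=
  (lintegral_mono' h le_rfl).trans_lt hν

lemma MemM2.add {μ ν : Measure ℝ} (hμ : MemM2 μ) (hν : MemM2 ν) : MemM2 (μ + ν) := by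
  rw [MemM2, lintegral_add_measure]
  exact ENNReal.add_lt_top.2 ⟨hμ, hν⟩

lemma memM2_volume : MemM2 (volume : Measure ℝ) := by
  have h := (integrable_inv_one_add_sq).hasFiniteIntegral
  rwa [hasFiniteIntegral_iff_ofReal (ae_of_all _ fun s => by positivity)] at h

lemma MemM2.smul {ν : Measure ℝ} (hν : MemM2 ν) {c : ENNReal} (hc : c ≠ ⊤) : MemM2 (c • ν) := by
  rw [MemM2, lintegral_smul_measure]
  exact ENNReal.mul_lt_top hc.lt_top hν

lemma MemM2.measure_closedBall_lt_top {ν : Measure ℝ} (hν : MemM2 ν) (s r : ℝ) :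
    ν (Metric.closedBall s r) < ⊤ := by
  have h := hν.integrable.measure_norm_ge_lt_top (ε := (1 + (|s| + r) ^ 2)⁻¹) (by positivity)
  refine (measure_mono fun t ht => ?_).trans_lt h
  have ht' : |t - s| ≤ r := by simpa [Real.dist_eq] using ht
  have h1 : |t| ≤ |s| + r := by
    have := abs_add_le (t - s) s
    rw [sub_add_cancel] at this
    linarith
  have h2 : t ^ 2 ≤ (|s| + r) ^ 2 := by
    rw [← sq_abs t]; gcongr
  rw [Set.mem_ofPred_eq, Real.norm_of_nonneg (by positivity)]
  gcongr

lemma MemM2.isLocallyFiniteMeasure {ν : Measure ℝ} (hν : MemM2 ν) : IsLocallyFiniteMeasure ν :=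
  ⟨fun s => ⟨Metric.closedBall s 1, Metric.closedBall_mem_nhds s one_pos,
    hν.measure_closedBall_lt_top s 1⟩⟩

lemma locallyIntegrable_acDensity (ν : Measure ℝ) [IsLocallyFiniteMeasure ν] :
    LocallyIntegrable (acDensity ν) volume := by
  intro s
  obtain ⟨u, hsu, hu, huf⟩ := ν.exists_isOpen_measure_lt_top s
  refine ⟨u, hu.mem_nhds hsu, ?_⟩
  refine integrable_toReal_of_lintegral_ne_top (Measure.measurable_rnDeriv _ _).aemeasurable ?_
  exact ((Measure.setLIntegral_rnDeriv_le u).trans_lt huf).ne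

lemma withDensity_acDensity (ν : Measure ℝ) [SigmaFinite ν] :
    volume.withDensity (ν.rnDeriv volume)
      = volume.withDensity fun s => ENNReal.ofReal (acDensity ν s) := by
  refine withDensity_congr_ae ?_
  filter_upwards [ν.rnDeriv_lt_top volume] with s hs
  rw [acDensity, ENNReal.ofReal_toReal hs.ne]

lemma acDensity_nonneg (ν : Measure ℝ) (s : ℝ) : 0 ≤ acDensity ν s := ENNReal.toReal_nonneg

lemma measurable_acDensity (ν : Measure ℝ) : Measurable (acDensity ν) :=
  (Measure.measurable_rnDeriv _ _).ennreal_toReal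

lemma ae_hasDensityZero_singularPart (ν : Measure ℝ) [IsLocallyFiniteMeasure ν] :
    ∀ᵐ s : ℝ, HasDensityZero (ν.singularPart volume) s := by
  have hloc : IsLocallyFiniteMeasure (ν.singularPart volume) :=
    Measure.isLocallyFiniteMeasure_of_le (Measure.singularPart_le ν volume)
  filter_upwards [Besicovitch.ae_tendsto_rnDeriv (ν.singularPart volume) volume,
    (Measure.mutuallySingular_singularPart ν volume).rnDeriv_ae_eq_zero] with s h1 h2
  rw [h2] at h1
  exact h1

/-- Almost every s is a Lebesgue point of the locally integrable density. -/
lemma ae_hasDensityZero_sub_acDensity (ν : Measure ℝ) [IsLocallyFiniteMeasure ν] :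
    ∀ᵐ s : ℝ, HasDensityZero
      (volume.withDensity fun t => ‖acDensity ν t - acDensity ν s‖ₑ) s := by
  filter_upwards [(Besicovitch.vitaliFamily (volume : Measure ℝ)).ae_tendsto_lintegral_enorm_sub_div
    (locallyIntegrable_acDensity ν)] with s hs
  have := hs.comp (Besicovitch.tendsto_filterAt volume s)
  refine this.congr fun r => ?_
  simp only [Function.comp_apply]
  rw [withDensity_apply _ Metric.isClosed_closedBall.measurableSet]

lemma HasDensityZero.add {σ τ : Measure ℝ} {s : ℝ} (h1 : HasDensityZero σ s)
    (h2 : HasDensityZero τ s) : HasDensityZero (σ + τ) s := by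
  have := Tendsto.add h1 h2
  rw [add_zero] at this
  refine this.congr fun r => ?_
  rw [Measure.add_apply, ENNReal.add_div]

/-- Fatou's theorem for Poisson integrals. -/
theorem ae_tendsto_poissonInt {ν : Measure ℝ} (hν : MemM2 ν) :
    ∀ᵐ s : ℝ, Tendsto (poissonInt ν) (coneFilter s)
      (𝓝 (ENNReal.ofReal (acDensity ν s) * ENNReal.ofReal Real.pi)) := by
  have := hν.isLocallyFiniteMeasure
  filter_upwards [ae_hasDensityZero_singularPart ν, ae_hasDensityZero_sub_acDensity ν]
    with s h1 h2
  set f := acDensity ν with hf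
  have hfm : Measurable f := measurable_acDensity ν
  have hdec : ν = ν.singularPart volume + volume.withDensity fun t => ENNReal.ofReal (f t) := by
    conv_lhs => rw [ν.haveLebesgueDecomposition_add volume]
    rw [withDensity_acDensity]
  have hconst : (ENNReal.ofReal (f s) • volume : Measure ℝ)
      = volume.withDensity fun _ => ENNReal.ofReal (f s) := by rw [withDensity_const]
  have hm1 : Measurable fun t => ‖f t - f s‖ₑ := by fun_prop
  have hm2 : Measurable fun t => ENNReal.ofReal (f t) := by fun_prop
  have hle1 : volume.withDensity (fun t => ENNReal.ofReal (f t))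
      ≤ ENNReal.ofReal (f s) • volume + volume.withDensity fun t => ‖f t - f s‖ₑ := by
    rw [hconst, ← withDensity_add_right _ hm1]
    refine withDensity_mono (ae_of_all _ fun t => ?_)
    simp only [Pi.add_apply, ← ofReal_norm, Real.norm_eq_abs]
    rw [← ENNReal.ofReal_add (acDensity_nonneg ν s) (abs_nonneg _)]
    exact ENNReal.ofReal_le_ofReal (by linarith [le_abs_self (f t - f s)])
  have hle2 : ENNReal.ofReal (f s) • volume ≤ volume.withDensity (fun t => ENNReal.ofReal (f t))
      + volume.withDensity fun t => ‖f t - f s‖ₑ := by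
    rw [hconst, ← withDensity_add_right _ hm1]
    refine withDensity_mono (ae_of_all _ fun t => ?_)
    simp only [Pi.add_apply, ← ofReal_norm, Real.norm_eq_abs]
    rw [← ENNReal.ofReal_add (acDensity_nonneg ν t) (abs_nonneg _)]
    exact ENNReal.ofReal_le_ofReal (by linarith [neg_abs_le (f t - f s)])
  -- Serves only to show that |f − f(s)| dt satisfies `MemM2`.
  have hle3 : (volume.withDensity fun t => ‖f t - f s‖ₑ) ≤ ν + ENNReal.ofReal (f s) • volume := by
    have : ν + ENNReal.ofReal (f s) • volume ≥ volume.withDensity (fun t => ENNReal.ofReal (f t))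
        + ENNReal.ofReal (f s) • volume := by
      gcongr
      conv_rhs => rw [hdec]
      exact Measure.le_add_left le_rfl
    refine le_trans ?_ this
    rw [hconst, ← withDensity_add_left hm2]
    refine withDensity_mono (ae_of_all _ fun t => ?_)
    simp only [Pi.add_apply, ← ofReal_norm, Real.norm_eq_abs]
    rw [← ENNReal.ofReal_add (acDensity_nonneg ν t) (acDensity_nonneg ν s)]
    refine ENNReal.ofReal_le_ofReal (abs_le.2 ⟨?_, ?_⟩) <;>
      linarith [acDensity_nonneg ν t, acDensity_nonneg ν s]
  refine tendsto_poissonInt_of_le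
    (σ := ν.singularPart volume + volume.withDensity fun t => ‖f t - f s‖ₑ)
    ((hν.mono (Measure.singularPart_le ν volume)).add
      ((hν.add (memM2_volume.smul ENNReal.ofReal_ne_top)).mono hle3)) (h1.add h2)
    ENNReal.ofReal_ne_top ?_ ?_
  · conv_lhs => rw [hdec]
    rw [add_left_comm]
    gcongr
  · refine hle2.trans ?_
    conv_rhs => rw [hdec]
    gcongr
    · exact Measure.le_add_left le_rfl
    · exact Measure.le_add_left le_rfl

/-- On the ball of radius Im z about s one has ‖z − t‖ ≤ 3 Im z. Poisson integrals therefore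
dominate averages: infinite density forces blow-up, and a vanishing Poisson integral forces zero
density. -/
lemma ofReal_inv_mul_measure_le_poissonInt (ν : Measure ℝ) {s : ℝ} {z : ℂ} (hz0 : 0 < z.im)
    (hz : ‖z - s‖ ≤ 2 * z.im) :
    ENNReal.ofReal (1 / (9 * z.im)) * ν (Metric.closedBall s z.im) ≤ poissonInt ν z := by
  rw [← setLIntegral_const]
  refine (setLIntegral_mono' Metric.isClosed_closedBall.measurableSet fun t ht => ?_).trans
    (setLIntegral_le_lintegral _ _)
  have ht' : |t - s| ≤ z.im := by simpa [Real.dist_eq] using ht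
  have h2 : ‖z - t‖ ≤ 3 * z.im := by
    have h3 : ‖z - t‖ ≤ ‖z - s‖ + ‖((t - s : ℝ) : ℂ)‖ := by
      rw [show z - (t : ℂ) = (z - s) - ((t - s : ℝ) : ℂ) by push_cast; ring]
      exact norm_sub_le _ _
    rw [Complex.norm_real, Real.norm_eq_abs] at h3
    linarith
  have h0 : 0 < ‖z - t‖ := norm_pos_iff.2 (sub_ofReal_ne_zero hz0 t)
  refine ENNReal.ofReal_le_ofReal ?_
  rw [div_le_div_iff₀ (by positivity) (by positivity)]
  nlinarith

/-- Poisson integrals blow up almost everywhere with respect to the singular part. -/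
theorem ae_singularPart_tendsto_poissonInt {μ : Measure ℝ} (hμ : MemM2 μ) :
    ∀ᵐ s ∂(μ.singularPart volume), Tendsto (poissonInt μ) (coneFilter s) (𝓝 ⊤) := by
  have := hμ.isLocallyFiniteMeasure
  have hloc : IsLocallyFiniteMeasure (μ.singularPart volume) :=
    Measure.isLocallyFiniteMeasure_of_le (Measure.singularPart_le μ volume)
  -- Lebesgue measure is differentiated with respect to the singular part: the ratio tends to 0, so
  -- its inverse tends to infinity.
  filter_upwards [Besicovitch.ae_tendsto_rnDeriv volume (μ.singularPart volume),
    (Measure.mutuallySingular_singularPart μ volume).symm.rnDeriv_ae_eq_zero] with s h1 h2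
  rw [h2] at h1
  have h3 := (tendsto_inv_iff.2 h1).comp (tendsto_im_coneFilter s)
  simp only [Pi.zero_apply, ENNReal.inv_zero] at h3
  have h4 := ENNReal.Tendsto.const_mul h3 (a := ENNReal.ofReal (2 / 9)) (Or.inl (by simp))
  rw [ENNReal.mul_top (by simp)] at h4
  refine tendsto_of_tendsto_of_tendsto_of_le_of_le' h4 tendsto_const_nhds ?_
    (Eventually.of_forall fun _ => le_top)
  filter_upwards [eventually_cone s] with z hz
  refine le_trans ?_ ((ofReal_inv_mul_measure_le_poissonInt (μ.singularPart volume) hz.1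
    hz.2).trans (poissonInt_mono (Measure.singularPart_le μ volume) z))
  have hz0 := hz.1
  simp only [Function.comp_apply]
  rw [ENNReal.inv_div (by simp [ENNReal.mul_eq_top]) (by simp [hz0]), Real.volume_closedBall, ENNReal.div_eq_inv_mul,
    ← mul_assoc, ← ENNReal.ofReal_inv_of_pos (by positivity),
    ← ENNReal.ofReal_mul (by norm_num)]
  refine le_of_eq ?_
  congr 2
  field_simp

/-! ### Boundary values of holomorphic functions with positive real part -/

lemma ae_tendsto_re_nevanlinna {ν : Measure ℝ} (hν : MemM2 ν) (a b : ℝ) :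
    ∀ᵐ s : ℝ, Tendsto (fun z => (nevanlinna ν a b z).re) (coneFilter s) (𝓝 (acDensity ν s)) := by
  filter_upwards [ae_tendsto_poissonInt hν] with s hs
  have h1 := (ENNReal.tendsto_toReal (ENNReal.mul_ne_top ENNReal.ofReal_ne_top
    ENNReal.ofReal_ne_top)).comp hs
  rw [ENNReal.toReal_mul, ENNReal.toReal_ofReal (acDensity_nonneg ν s),
    ENNReal.toReal_ofReal Real.pi_pos.le] at h1
  have h2 := ((tendsto_im_coneFilter s).mono_right nhdsWithin_le_nhds).const_mul b
  have h3 := (h1.add h2).const_mul Real.pi⁻¹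
  rw [mul_zero, add_zero, mul_comm (acDensity ν s), inv_mul_cancel_left₀ Real.pi_ne_zero] at h3
  refine h3.congr' ?_
  filter_upwards [eventually_cone s] with z hz
  rw [re_nevanlinna hν a b hz.1]
  rfl

lemma ae_exists_tendsto_re {G : ℂ → ℂ} (hG : DifferentiableOn ℂ G {z | 0 < z.im})
    (hG0 : ∀ z : ℂ, 0 < z.im → 0 ≤ (G z).re) :
    ∀ᵐ s : ℝ, ∃ x : ℝ, Tendsto (fun z => (G z).re) (coneFilter s) (𝓝 x) := by
  obtain ⟨μ, a, b, hμ, -, h⟩ := exists_nevanlinna_eq hG hG0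
  filter_upwards [ae_tendsto_re_nevanlinna hμ a b] with s hs
  exact ⟨_, hs.congr' ((eventually_cone s).mono fun z hz => by simp only [h z hz.1])⟩

/-- A holomorphic function with positive real part has nontangential limits almost everywhere. -/
theorem ae_exists_tendsto_of_re_pos {G : ℂ → ℂ} (hG : DifferentiableOn ℂ G {z | 0 < z.im})
    (hG0 : ∀ z : ℂ, 0 < z.im → 0 < (G z).re) :
    ∀ᵐ s : ℝ, ∃ L : ℂ, Tendsto G (coneFilter s) (𝓝 L) := by
  -- The square root of G takes values in the sector |arg| < π/4. Hence u and (1 + i)u both have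
  -- non-negative real part; Fatou's theorem for these two gives limits of Re u and Re u − Im u,
  -- thus of u and of G = u².
  let u : ℂ → ℂ := fun z => Complex.exp (Complex.log (G z) / 2)
  have hne : ∀ z : ℂ, 0 < z.im → G z ≠ 0 := fun z hz h => by
    have := hG0 z hz
    simp [h] at this
  have hu : DifferentiableOn ℂ u {z | 0 < z.im} :=
    ((hG.clog fun z hz => Or.inl (hG0 z hz)).div_const 2).cexp
  have husq : ∀ z : ℂ, 0 < z.im → u z ^ 2 = G z := by
    intro z hz
    rw [← Complex.exp_nat_mul]
    push_cast
    rw [mul_div_cancel₀ _ two_ne_zero, Complex.exp_log (hne z hz)]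
  have hure : ∀ z : ℂ, 0 < z.im → 0 < (u z).re := by
    intro z hz
    have h1 := Complex.abs_arg_lt_pi_div_two_iff.2 (Or.inl (hG0 z hz))
    rw [abs_lt] at h1
    rw [Complex.exp_re]
    refine mul_pos (Real.exp_pos _) (Real.cos_pos_of_mem_Ioo ?_)
    have h2 : (Complex.log (G z) / 2).im = (G z).arg / 2 := by
      rw [Complex.div_ofNat_im, Complex.log_im]
    rw [h2]
    constructor <;> linarith [Real.pi_pos]
  have huim : ∀ z : ℂ, 0 < z.im → (u z).im < (u z).re := by
    intro z hz
    have h1 := hG0 z hz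
    rw [← husq z hz, sq, Complex.mul_re] at h1
    nlinarith [hure z hz]
  filter_upwards [ae_exists_tendsto_re hu fun z hz => (hure z hz).le,
    ae_exists_tendsto_re (G := fun z => (1 + Complex.I) * u z) (hu.const_mul _)
      fun z hz => by simpa using (huim z hz).le] with s ⟨x, hx⟩ ⟨y, hy⟩
  have him : Tendsto (fun z => (u z).im) (coneFilter s) (𝓝 (x - y)) := by
    refine (hx.sub hy).congr fun z => ?_
    simp
  have hlim : Tendsto u (coneFilter s) (𝓝 (x + (x - y : ℝ) * Complex.I)) := by
    have h1 := ((Complex.continuous_ofReal.tendsto _).comp hx).add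
      (((Complex.continuous_ofReal.tendsto _).comp him).mul_const Complex.I)
    refine h1.congr fun z => ?_
    simp [Complex.re_add_im]
  exact ⟨_, (hlim.pow 2).congr' ((eventually_cone s).mono fun z hz => husq z hz.1)⟩

/-! ### Point masses -/

instance coneFilter_isCountablyGenerated (s : ℝ) : (coneFilter s).IsCountablyGenerated := by
  unfold coneFilter
  infer_instance

/-- Dominated convergence: (z − α) times the kernel tends to (i/π)1_{s = α}, and ‖z − α‖ ≤ 2 Im z
bounds it by a multiple of (1 + s²)⁻¹. -/
lemma tendsto_sub_mul_cauchyReg {μ : Measure ℝ} (hμ : MemM2 μ) (α : ℝ) :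
    Tendsto (fun z : ℂ => (z - α) * cauchyReg μ z) (coneFilter α)
      (𝓝 (Complex.I / Real.pi * (μ.real {α} : ℂ))) := by
  have hlim : (Complex.I / Real.pi * (μ.real {α} : ℂ))
      = ∫ s, Set.indicator {α} (fun _ => Complex.I / (Real.pi : ℂ)) s ∂μ := by
    rw [integral_indicator_const _ (measurableSet_singleton α), Complex.real_smul, mul_comm]
  have hid : Tendsto (fun z : ℂ => z) (coneFilter α) (𝓝 (α : ℂ)) := coneFilter_le_nhds α
  have hsub : Tendsto (fun z : ℂ => z - α) (coneFilter α) (𝓝 0) := by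
    simpa using hid.sub_const (α : ℂ)
  have hfun : (fun z : ℂ => (z - α) * cauchyReg μ z)
      = fun z : ℂ => ∫ s, (z - α) * regKernel z s ∂μ := by
    funext z
    rw [integral_const_mul]
    rfl
  rw [hlim, hfun]
  have hC : ∀ᶠ z : ℂ in coneFilter α,
      2 * ‖1 + z ^ 2‖ + ‖z‖ * ‖z - α‖ < 2 * ‖1 + (α : ℂ) ^ 2‖ + 1 := by
    have hc : Continuous fun z : ℂ => 2 * ‖1 + z ^ 2‖ + ‖z‖ * ‖z - α‖ := by fun_prop
    have := (hc.tendsto (α : ℂ)).comp hid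
    refine this.eventually (gt_mem_nhds ?_)
    simp
  refine tendsto_integral_filter_of_dominated_convergence
    (fun s => (2 * ‖1 + (α : ℂ) ^ 2‖ + 1) * (1 + s ^ 2)⁻¹) ?_ ?_
    (hμ.integrable.const_mul _) (ae_of_all _ fun s => ?_)
  · exact Eventually.of_forall fun z => ((measurable_regKernel z).const_mul _).aestronglyMeasurable
  · filter_upwards [eventually_cone α, hC] with z hz hz2
    refine ae_of_all _ fun s => ?_
    have hz0 := hz.1
    rw [norm_mul]
    calc ‖z - α‖ * ‖regKernel z s‖
        ≤ ‖z - α‖ * ((‖1 + z ^ 2‖ / ‖z - s‖ + ‖z‖) * (1 + s ^ 2)⁻¹) := by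
          gcongr
          exact norm_regKernel_le (sub_ofReal_ne_zero hz0 s)
      _ ≤ ‖z - α‖ * ((‖1 + z ^ 2‖ / z.im + ‖z‖) * (1 + s ^ 2)⁻¹) := by
          gcongr
          exact norm_sub_ofReal_ge_im s
      _ = ((‖z - α‖ / z.im) * ‖1 + z ^ 2‖ + ‖z‖ * ‖z - α‖) * (1 + s ^ 2)⁻¹ := by ring
      _ ≤ (2 * ‖1 + z ^ 2‖ + ‖z‖ * ‖z - α‖) * (1 + s ^ 2)⁻¹ := by
          gcongr
          rw [div_le_iff₀ hz0]
          exact hz.2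
      _ ≤ _ := by gcongr
  · by_cases hs : s = α
    · subst hs
      have h1 : Tendsto (fun z : ℂ => Complex.I / Real.pi * (1 + (z - s) * (s / (1 + (s : ℂ) ^ 2))))
          (coneFilter s) (𝓝 (Complex.I / Real.pi * (1 + 0 * (s / (1 + (s : ℂ) ^ 2))))) :=
        ((hsub.mul_const _).const_add 1).const_mul _
      rw [zero_mul, add_zero, mul_one] at h1
      rw [Set.indicator_of_mem (Set.mem_singleton s)]
      refine h1.congr' ?_
      filter_upwards [eventually_cone s] with z hz
      have := sub_ofReal_ne_zero hz.1 s
      rw [regKernel]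
      field_simp
    · have hne : (α : ℂ) - s ≠ 0 := sub_ne_zero.2 (by exact_mod_cast Ne.symm hs)
      have h1 : Tendsto (fun z : ℂ => regKernel z s) (coneFilter α) (𝓝 (regKernel α s)) := by
        unfold regKernel
        exact ((tendsto_const_nhds.div (hid.sub_const _) hne).add_const _).const_mul _
      have h2 := hsub.mul h1
      rw [zero_mul] at h2
      rwa [Set.indicator_of_notMem (by simpa using hs)]

lemma tendsto_sub_mul_nevanlinna {μ : Measure ℝ} (hμ : MemM2 μ) (a b α : ℝ) :
    Tendsto (fun z : ℂ => (z - α) * nevanlinna μ a b z) (coneFilter α)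
      (𝓝 (Complex.I / Real.pi * (μ.real {α} : ℂ))) := by
  have hc : Continuous fun z : ℂ => (z - α) * (Complex.I * (Real.pi : ℂ)⁻¹ * (a + b * z)) := by
    fun_prop
  have h := (tendsto_sub_mul_cauchyReg hμ α).sub ((hc.tendsto (α : ℂ)).mono_left
    (coneFilter_le_nhds α))
  rw [sub_self, zero_mul, sub_zero] at h
  refine h.congr fun z => ?_
  rw [nevanlinna]
  ring

lemma tendsto_lintegral_top {ι : Type*} {l : Filter ι} [l.IsCountablyGenerated] [l.NeBot]
    {ν : Measure ℝ} {f : ι → ℝ → ENNReal} {g : ℝ → ENNReal} (hf : ∀ i, Measurable (f i))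
    (hfg : ∀ s, Tendsto (fun i => f i s) l (𝓝 (g s))) (hg : ∫⁻ s, g s ∂ν = ⊤) :
    Tendsto (fun i => ∫⁻ s, f i s ∂ν) l (𝓝 ⊤) := by
  refine tendsto_of_le_liminf_of_limsup_le ?_ le_top
  rw [← hg]
  refine le_trans (le_of_eq (lintegral_congr fun s => ?_)) (lintegral_liminf_le hf)
  exact ((hfg s).liminf_eq).symm

/-- The quotient is π⁻¹(b + ∫‖z − τ‖⁻² dν), which diverges by Fatou's lemma. This is the case of
weight zero. -/
lemma tendsto_re_nevanlinna_div_im {ν : Measure ℝ} (hν : MemM2 ν) (a : ℝ) {b : ℝ} (hb : 0 ≤ b)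
    {α : ℝ} (h : ∫⁻ τ, (ENNReal.ofReal ((τ - α) ^ 2))⁻¹ ∂ν = ⊤) :
    Tendsto (fun z : ℂ => (nevanlinna ν a b z).re / z.im) (coneFilter α) atTop := by
  have hid : Tendsto (fun z : ℂ => z) (coneFilter α) (𝓝 (α : ℂ)) := coneFilter_le_nhds α
  have h1 : Tendsto (fun z : ℂ => ∫⁻ τ, (ENNReal.ofReal (‖z - τ‖ ^ 2))⁻¹ ∂ν) (coneFilter α)
      (𝓝 ⊤) := by
    refine tendsto_lintegral_top (fun z => by fun_prop) (fun τ => ?_) h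
    refine tendsto_inv_iff.2 (ENNReal.tendsto_ofReal ?_)
    have h2 := ((hid.sub_const (τ : ℂ)).norm).pow 2
    rwa [← Complex.ofReal_sub, Complex.norm_real, Real.norm_eq_abs, sq_abs, sub_sq_comm] at h2
  refine tendsto_atTop.2 fun M => ?_
  filter_upwards [eventually_cone α, h1.eventually
    (lt_mem_nhds (ENNReal.ofReal_lt_top (r := Real.pi * M)))] with z hz hz2
  have hz0 := hz.1
  have h3 : ENNReal.ofReal (Real.pi * M * z.im) ≤ poissonInt ν z := by
    have : poissonInt ν z
        = (∫⁻ τ, (ENNReal.ofReal (‖z - τ‖ ^ 2))⁻¹ ∂ν) * ENNReal.ofReal z.im := by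
      rw [← lintegral_mul_const _ (by fun_prop), poissonInt]
      refine lintegral_congr fun τ => ?_
      have := norm_pos_iff.2 (sub_ofReal_ne_zero hz0 τ)
      rw [← ENNReal.ofReal_inv_of_pos (by positivity), ← ENNReal.ofReal_mul (by positivity)]
      congr 1
      ring
    rw [this, ENNReal.ofReal_mul' hz0.le]
    gcongr
  have h4 := (ENNReal.ofReal_le_iff_le_toReal (poissonInt_lt_top hν hz0).ne).1 h3
  have hpi := Real.pi_pos
  rw [re_nevanlinna hν a b hz0, le_div_iff₀ hz0]
  calc M * z.im = Real.pi⁻¹ * (Real.pi * M * z.im) := by field_simp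
    _ ≤ _ := by
      gcongr
      nlinarith

/-- N is the defining formula evaluated at α itself, where the integrand is imaginary. The kernel's
difference quotient is −(i/π)((z − τ)(α − τ))⁻¹, and in the cone ((z − τ)(α − τ))⁻¹ is dominated by
3(τ − α)⁻². -/
lemma exists_tendsto_nevanlinna_sub_div {ν : Measure ℝ} (hν : MemM2 ν) (a b : ℝ)
    {α : ℝ} (h : ∫⁻ τ, (ENNReal.ofReal ((τ - α) ^ 2))⁻¹ ∂ν ≠ ⊤) :
    ∃ N : ℂ, N.re = 0 ∧ Tendsto (fun z : ℂ => (nevanlinna ν a b z - N) / (z - α)) (coneFilter α)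
      (𝓝 (-(Complex.I / Real.pi) *
        (((b + (∫⁻ τ, (ENNReal.ofReal ((τ - α) ^ 2))⁻¹ ∂ν).toReal : ℝ) : ℂ)))) := by
  have hid : Tendsto (fun z : ℂ => z) (coneFilter α) (𝓝 (α : ℂ)) := coneFilter_le_nhds α
  have hpi : (Real.pi : ℂ) ≠ 0 := by exact_mod_cast Real.pi_ne_zero
  -- The inverse of 0 is ∞ in `ENNReal`, so finiteness excludes an atom at α. The real inverse,
  -- which is 0 there, may then be used.
  have hae : ∀ᵐ τ ∂ν, τ ≠ α := by
    filter_upwards [ae_lt_top (by fun_prop) h] with τ hτ hτα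
    simp [hτα] at hτ
  have hcongr : ∀ᵐ τ ∂ν, (ENNReal.ofReal ((τ - α) ^ 2))⁻¹ = ENNReal.ofReal (((τ - α) ^ 2)⁻¹) := by
    filter_upwards [hae] with τ hτ
    have : τ - α ≠ 0 := sub_ne_zero.2 hτ
    rw [ENNReal.ofReal_inv_of_pos (by positivity)]
  have hint : Integrable (fun τ : ℝ => ((τ - α) ^ 2)⁻¹) ν := by
    refine ⟨Measurable.aestronglyMeasurable (by fun_prop), ?_⟩
    rw [hasFiniteIntegral_iff_ofReal (ae_of_all _ fun s => by positivity),
      ← lintegral_congr_ae hcongr]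
    exact h.lt_top
  have hval : (∫⁻ τ, (ENNReal.ofReal ((τ - α) ^ 2))⁻¹ ∂ν).toReal = ∫ τ, ((τ - α) ^ 2)⁻¹ ∂ν := by
    rw [lintegral_congr_ae hcongr, integral_eq_lintegral_of_nonneg_ae
      (ae_of_all _ fun s => by positivity) hint.aestronglyMeasurable]
  let D : ℂ → ℝ → ℂ := fun z τ => ((z - τ) * (α - τ))⁻¹
  have hDm : ∀ z, AEStronglyMeasurable (D z) ν := fun z => Measurable.aestronglyMeasurable (by
    simp only [D]; fun_prop)
  have hDb : ∀ z : ℂ, 0 < z.im ∧ ‖z - α‖ ≤ 2 * z.im → ∀ τ : ℝ,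
      ‖D z τ‖ ≤ 3 * ((τ - α) ^ 2)⁻¹ := by
    intro z hz τ
    rcases eq_or_ne τ α with rfl | hτ
    · simp [D]
    have h1 := cone_abs_sub_le hz.2 τ
    have h2 : 0 < |τ - α| := abs_pos.2 (sub_ne_zero.2 hτ)
    have h3 : ‖(α : ℂ) - τ‖ = |τ - α| := by
      rw [← Complex.ofReal_sub, Complex.norm_real, Real.norm_eq_abs, abs_sub_comm]
    simp only [D, norm_inv, norm_mul, h3]
    rw [← sq_abs (τ - α), ← div_eq_mul_inv, inv_eq_one_div,
      div_le_div_iff₀ (by nlinarith) (by positivity)]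
    nlinarith
  have hDlim : Tendsto (fun z => ∫ τ, D z τ ∂ν) (coneFilter α)
      (𝓝 (((∫⁻ τ, (ENNReal.ofReal ((τ - α) ^ 2))⁻¹ ∂ν).toReal : ℝ) : ℂ)) := by
    rw [hval, ← integral_complex_ofReal]
    refine tendsto_integral_filter_of_dominated_convergence (fun τ => 3 * ((τ - α) ^ 2)⁻¹)
      (Eventually.of_forall hDm) ?_ (hint.const_mul 3) ?_
    · filter_upwards [eventually_cone α] with z hz
      exact ae_of_all _ (hDb z hz)
    · filter_upwards [hae] with τ hτ
      have hne : ((α : ℂ) - τ) * (α - τ) ≠ 0 := by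
        have : (α : ℂ) - τ ≠ 0 := sub_ne_zero.2 (by exact_mod_cast hτ.symm)
        exact mul_self_ne_zero.2 this
      have h1 := ((hid.sub_const (τ : ℂ)).mul_const ((α : ℂ) - τ)).inv₀ hne
      refine h1.trans (le_of_eq ?_)
      push_cast
      congr 2
      ring
  have hre : ∫ τ, regKernel α τ ∂ν
      = Complex.I * (∫ τ, Real.pi⁻¹ * (1 / (α - τ) + τ / (1 + τ ^ 2)) ∂ν : ℝ) := by
    rw [← integral_complex_ofReal, ← integral_const_mul]
    refine integral_congr_ae (ae_of_all _ fun τ => ?_)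
    simp only [regKernel]
    push_cast
    ring
  refine ⟨(∫ τ, regKernel α τ ∂ν) - Complex.I * (Real.pi : ℂ)⁻¹ * (a + b * α), ?_, ?_⟩
  · rw [hre, show ∀ x : ℝ, Complex.I * (x : ℂ) - Complex.I * (Real.pi : ℂ)⁻¹ * (a + b * α)
      = Complex.I * ((x - Real.pi⁻¹ * (a + b * α) : ℝ) : ℂ) by intro x; push_cast; ring]
    simp
  have hfin := (hDlim.const_add (b : ℂ)).const_mul (-(Complex.I / (Real.pi : ℂ)))
  push_cast
  refine hfin.congr' ?_
  filter_upwards [eventually_cone α] with z hz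
  have hz0 : z - α ≠ 0 := sub_ofReal_ne_zero hz.1 α
  have hDi : Integrable (D z) ν := (hint.const_mul 3).mono' (hDm z) (ae_of_all _ (hDb z hz))
  have hker : ∀ᵐ τ ∂ν, regKernel α τ = regKernel z τ + Complex.I / Real.pi * (z - α) * D z τ := by
    filter_upwards [hae] with τ hτ
    have h1 : (α : ℂ) - τ ≠ 0 := sub_ne_zero.2 (by exact_mod_cast hτ.symm)
    have h2 := sub_ofReal_ne_zero hz.1 τ
    simp only [regKernel, D]
    field_simp
    ring
  have h1 : ∫ τ, regKernel α τ ∂ν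
      = cauchyReg ν z + Complex.I / Real.pi * (z - α) * ∫ τ, D z τ ∂ν := by
    rw [integral_congr_ae hker, integral_add (integrable_regKernel hν hz.1) (hDi.const_mul _),
      integral_const_mul]
    rfl
  rw [h1, nevanlinna]
  field_simp
  ring

/-- The mass of the dual measure at a boundary zero. -/
theorem measure_singleton_eq_atomWeight {lam μ : Measure ℝ} (hlam : MemM2 lam) (hlam0 : lam ≠ 0)
    (hμ : MemM2 μ) {c₀ c₁ a b : ℝ} (hc₁ : 0 ≤ c₁)
    (hFG : ∀ z : ℂ, 0 < z.im → nevanlinna lam c₀ c₁ z * nevanlinna μ a b z = 1) {α : ℝ}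
    {l : Filter ℂ} [l.NeBot] (hl : l ≤ coneFilter α)
    (hF : Tendsto (fun z => (nevanlinna lam c₀ c₁ z).im) l (𝓝 0)) : μ {α} = atomWeight lam c₁ α := by
  have := hμ.isLocallyFiniteMeasure
  have hpi := Real.pi_pos
  have hpi' : (Real.pi : ℂ) ≠ 0 := by exact_mod_cast hpi.ne'
  have hμα : μ {α} ≠ ⊤ := measure_singleton_lt_top.ne
  have hG := tendsto_sub_mul_nevanlinna hμ a b α
  have hGF : ∀ᶠ z : ℂ in coneFilter α,
      (z - α) * nevanlinna μ a b z = (nevanlinna lam c₀ c₁ z / (z - α))⁻¹ := by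
    filter_upwards [eventually_cone α] with z hz
    rw [inv_div, eq_div_iff (left_ne_zero_of_mul_eq_one (hFG z hz.1)), mul_assoc,
      mul_comm (nevanlinna μ a b z), hFG z hz.1, mul_one]
  have hreal : ∀ x : ℝ, 0 ≤ x → Tendsto (fun z : ℂ => (z - α) * nevanlinna μ a b z) (coneFilter α)
      (𝓝 (Complex.I / Real.pi * (x : ℂ))) → μ {α} = ENNReal.ofReal x := by
    intro x hx hxl
    have h := tendsto_nhds_unique hG hxl
    have h2 := mul_left_cancel₀ (div_ne_zero Complex.I_ne_zero hpi') h
    have h3 : μ.real {α} = x := by exact_mod_cast h2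
    rw [← h3, ofReal_measureReal hμα]
  set W := ∫⁻ τ, (ENNReal.ofReal ((τ - α) ^ 2))⁻¹ ∂lam with hW
  rcases eq_or_ne W ⊤ with htop | htop
  · have h1 := tendsto_re_nevanlinna_div_im hlam c₀ hc₁ htop
    rw [atomWeight, ← hW, htop, add_top, ENNReal.inv_top, mul_zero]
    refine (hreal 0 le_rfl ?_).trans ENNReal.ofReal_zero
    rw [Complex.ofReal_zero, mul_zero]
    have h2 := (h1.inv_tendsto_atTop).const_mul 2
    rw [mul_zero] at h2
    refine squeeze_zero_norm' ?_ h2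
    filter_upwards [hGF, eventually_cone α, h1.eventually_gt_atTop 0] with z hz hz2 hz3
    have hz0 := hz2.1
    have hre : 0 < (nevanlinna lam c₀ c₁ z).re := by
      by_contra hneg
      exact absurd hz3 (not_lt.2 (div_nonpos_of_nonpos_of_nonneg (not_lt.1 hneg) hz0.le))
    have hle := Complex.re_le_norm (nevanlinna lam c₀ c₁ z)
    rw [hz, norm_inv, norm_div, inv_div, Pi.inv_apply, inv_div, ← mul_div_assoc]
    exact div_le_div₀ (by positivity) hz2.2 hre hle
  · have hWpos : 0 < W := by
      rw [pos_iff_ne_zero, hW, Ne, lintegral_eq_zero_iff (by fun_prop)]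
      intro h
      apply hlam0
      rw [← ae_eq_bot, ← Filter.empty_mem_iff_bot]
      refine mem_of_superset h fun s hs => ?_
      simp at hs
    obtain ⟨N, hNre, hN⟩ := exists_tendsto_nevanlinna_sub_div hlam c₀ c₁ htop
    rw [← hW] at hN
    have hsub : Tendsto (fun z : ℂ => z - α) (coneFilter α) (𝓝 0) := by
      have : Tendsto (fun z : ℂ => z) (coneFilter α) (𝓝 (α : ℂ)) := coneFilter_le_nhds α
      simpa using this.sub_const (α : ℂ)
    -- Im F → 0 is known only along l, but F already converges to the imaginary number N in the
    -- whole cone.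
    have hN0 : N = 0 := by
      have h1 := hN.mul hsub
      rw [mul_zero] at h1
      have h2 : Tendsto (fun z => nevanlinna lam c₀ c₁ z - N) (coneFilter α) (𝓝 0) := by
        refine h1.congr' ?_
        filter_upwards [eventually_cone α] with z hz
        exact div_mul_cancel₀ _ (sub_ofReal_ne_zero hz.1 α)
      have h3 := (Complex.continuous_im.tendsto _).comp (h2.mono_left hl)
      have h4 := tendsto_nhds_unique h3 ((hF.sub_const N.im).congr fun z => by simp)
      exact Complex.ext hNre (by simpa using h4.symm)
    simp only [hN0, sub_zero] at hN
    have hpos : 0 < c₁ + W.toReal := add_pos_of_nonneg_of_pos hc₁ (ENNReal.toReal_pos hWpos.ne' htop)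
    have hne : ((c₁ + W.toReal : ℝ) : ℂ) ≠ 0 := by exact_mod_cast hpos.ne'
    have h1 := hN.inv₀ (mul_ne_zero (neg_ne_zero.2 (div_ne_zero Complex.I_ne_zero hpi')) hne)
    -- The witness comes from (−(i/π)x)⁻¹ = (i/π)·π²x⁻¹.
    rw [hreal (Real.pi ^ 2 * (c₁ + W.toReal)⁻¹) (by positivity) ?_, atomWeight, ← hW,
      ENNReal.ofReal_mul (by positivity), ENNReal.ofReal_inv_of_pos hpos,
      ENNReal.ofReal_add hc₁ ENNReal.toReal_nonneg, ENNReal.ofReal_toReal htop]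
    refine (h1.congr' (hGF.mono fun z hz => hz.symm)).trans (le_of_eq ?_)
    congr 1
    push_cast at hne ⊢
    have hI : Complex.I ^ 2 = -1 := Complex.I_sq
    have hI0 := Complex.I_ne_zero
    field_simp
    linear_combination -hI

/-! ### Behaviour at infinity and at `i` -/

lemma norm_ofReal_mul_I {y : ℝ} (hy : 0 < y) : ‖(y : ℂ) * Complex.I‖ = y := by
  simp [abs_of_pos hy]

lemma ofReal_mul_I_im (y : ℝ) : ((y : ℂ) * Complex.I).im = y := by simp

lemma le_norm_ofReal_mul_I_sub (y s : ℝ) : y ≤ ‖(y : ℂ) * Complex.I - s‖ := by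
  simpa only [ofReal_mul_I_im] using norm_sub_ofReal_ge_im (z := (y : ℂ) * Complex.I) s

lemma ofReal_mul_I_sub_ne_zero {y : ℝ} (hy : 0 < y) (s : ℝ) : (y : ℂ) * Complex.I - s ≠ 0 :=
  sub_ofReal_ne_zero (by rwa [ofReal_mul_I_im]) s

lemma tendsto_inv_ofReal_mul_I_sub (s : ℝ) :
    Tendsto (fun y : ℝ => ((y : ℂ) * Complex.I - s)⁻¹) atTop (𝓝 0) := by
  refine squeeze_zero_norm' ?_ tendsto_inv_atTop_zero
  filter_upwards [eventually_gt_atTop 0] with y hy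
  rw [norm_inv]
  exact inv_anti₀ hy (le_norm_ofReal_mul_I_sub y s)

lemma tendsto_inv_ofReal_mul_I :
    Tendsto (fun y : ℝ => ((y : ℂ) * Complex.I)⁻¹) atTop (𝓝 0) := by
  simpa using tendsto_inv_ofReal_mul_I_sub 0

/-- The integral is o(y) on the imaginary axis, so the linear coefficient can be read off. For y ≥
1, (1 + y²)/y + y ≤ 3y gives the majorant. -/
lemma tendsto_cauchyReg_div_atTop {μ : Measure ℝ} (hμ : MemM2 μ) :
    Tendsto (fun y : ℝ => cauchyReg μ (y * Complex.I) / (y * Complex.I)) atTop (𝓝 0) := by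
  have hfun : (fun y : ℝ => cauchyReg μ (y * Complex.I) / (y * Complex.I))
      = fun y : ℝ => ∫ s, regKernel (y * Complex.I) s / (y * Complex.I) ∂μ := by
    funext y
    rw [integral_div]
    rfl
  have h0 : (0 : ℂ) = ∫ _ : ℝ, (0 : ℂ) ∂μ := by simp
  rw [hfun, h0]
  refine tendsto_integral_filter_of_dominated_convergence (fun s => 3 * (1 + s ^ 2)⁻¹)
    (Eventually.of_forall fun y => ((measurable_regKernel _).div_const _).aestronglyMeasurable)
    ?_ (hμ.integrable.const_mul 3) (ae_of_all _ fun s => ?_)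
  · filter_upwards [eventually_ge_atTop 1] with y hy
    have hy0 : 0 < y := by linarith
    refine ae_of_all _ fun s => ?_
    rw [norm_div, norm_ofReal_mul_I hy0, div_le_iff₀ hy0]
    refine (norm_regKernel_le (ofReal_mul_I_sub_ne_zero hy0 s)).trans ?_
    have h1 := le_norm_ofReal_mul_I_sub y s
    have h2 : ‖1 + ((y : ℂ) * Complex.I) ^ 2‖ ≤ 1 + y ^ 2 := by
      refine (norm_add_le _ _).trans ?_
      rw [norm_one, norm_pow, norm_ofReal_mul_I hy0]
    rw [norm_ofReal_mul_I hy0]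
    have h3 : ‖1 + ((y : ℂ) * Complex.I) ^ 2‖ / ‖(y : ℂ) * Complex.I - s‖ ≤ (1 + y ^ 2) / y := by
      gcongr
    have h4 : (1 + y ^ 2) / y ≤ 2 * y := by
      rw [div_le_iff₀ hy0]; nlinarith
    have h5 : 0 ≤ (1 + s ^ 2)⁻¹ := by positivity
    nlinarith
  · have h1 := (((tendsto_inv_ofReal_mul_I_sub s).add_const (s / (1 + (s : ℂ) ^ 2))).const_mul
      (Complex.I / (Real.pi : ℂ))).mul tendsto_inv_ofReal_mul_I
    rw [mul_zero] at h1
    refine h1.congr fun y => ?_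
    rw [regKernel, one_div, div_eq_mul_inv _ ((y : ℂ) * Complex.I)]

lemma tendsto_nevanlinna_div_atTop {μ : Measure ℝ} (hμ : MemM2 μ) (a b : ℝ) :
    Tendsto (fun y : ℝ => nevanlinna μ a b (y * Complex.I) / (y * Complex.I)) atTop
      (𝓝 (-(Complex.I / Real.pi) * b)) := by
  have h1 := (tendsto_cauchyReg_div_atTop hμ).sub
    ((((tendsto_inv_ofReal_mul_I).const_mul (a : ℂ)).add_const (b : ℂ)).const_mul
      (Complex.I * (Real.pi : ℂ)⁻¹))
  rw [mul_zero, zero_add, zero_sub, ← neg_mul, ← div_eq_mul_inv] at h1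
  refine h1.congr' ?_
  filter_upwards [eventually_gt_atTop 0] with y hy
  have hy' : (y : ℂ) ≠ 0 := by exact_mod_cast hy.ne'
  have := Complex.I_ne_zero
  have hpi' : (Real.pi : ℂ) ≠ 0 := by exact_mod_cast Real.pi_ne_zero
  rw [nevanlinna]
  field_simp

lemma integrable_div_one_add_sq (ν : Measure ℝ) [IsFiniteMeasure ν] :
    Integrable (fun s : ℝ => s / (1 + s ^ 2)) ν := by
  refine (integrable_const (1 : ℝ)).mono' (Measurable.aestronglyMeasurable (by fun_prop))
    (ae_of_all _ fun s => ?_)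
  rw [Real.norm_eq_abs, abs_div, abs_of_pos (by positivity : (0 : ℝ) < 1 + s ^ 2),
    div_le_one (by positivity)]
  nlinarith [sq_abs s, sq_nonneg (|s| - 1)]

lemma integrable_inv_ofReal_mul_I_sub (ν : Measure ℝ) [IsFiniteMeasure ν] {y : ℝ} (hy : 0 < y) :
    Integrable (fun s : ℝ => ((y : ℂ) * Complex.I - s)⁻¹) ν := by
  refine (integrable_const y⁻¹).mono' (Measurable.aestronglyMeasurable (by fun_prop))
    (ae_of_all _ fun s => ?_)
  rw [norm_inv]
  exact inv_anti₀ hy (le_norm_ofReal_mul_I_sub y s)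

/-- For finite ν the regularizing term integrates separately. The resulting constant decides whether
F(iy) decays, hence the exceptional case of ζ₁. -/
lemma nevanlinna_eq_of_isFiniteMeasure (ν : Measure ℝ) [IsFiniteMeasure ν] (a : ℝ) {y : ℝ}
    (hy : 0 < y) : nevanlinna ν a 0 (y * Complex.I) = Complex.I / Real.pi *
      ((∫ s : ℝ, ((y : ℂ) * Complex.I - s)⁻¹ ∂ν) + ((∫ s : ℝ, s / (1 + s ^ 2) ∂ν) - a : ℝ)) := by
  have h1 : cauchyReg ν (y * Complex.I) = Complex.I / Real.pi *
      ((∫ s : ℝ, ((y : ℂ) * Complex.I - s)⁻¹ ∂ν) + (∫ s : ℝ, s / (1 + s ^ 2) ∂ν : ℝ)) := by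
    have h2 : Integrable (fun s : ℝ => ((s / (1 + s ^ 2) : ℝ) : ℂ)) ν :=
      (integrable_div_one_add_sq ν).ofReal
    rw [cauchyReg, integral_const_mul, ← integral_complex_ofReal, ← integral_add
      (integrable_inv_ofReal_mul_I_sub ν hy) h2]
    congr 1
    refine integral_congr_ae (ae_of_all _ fun s => ?_)
    simp
  rw [nevanlinna, h1]
  push_cast
  ring

lemma tendsto_mul_integral_inv_ofReal_mul_I_sub (ν : Measure ℝ) [IsFiniteMeasure ν] :
    Tendsto (fun y : ℝ => ((y : ℂ) * Complex.I) * ∫ s : ℝ, ((y : ℂ) * Complex.I - s)⁻¹ ∂ν) atTop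
      (𝓝 (ν.real Set.univ : ℂ)) := by
  have hfun : (fun y : ℝ => ((y : ℂ) * Complex.I) * ∫ s : ℝ, ((y : ℂ) * Complex.I - s)⁻¹ ∂ν)
      = fun y : ℝ => ∫ s : ℝ, ((y : ℂ) * Complex.I) * ((y : ℂ) * Complex.I - s)⁻¹ ∂ν := by
    funext y
    rw [integral_const_mul]
  have h0 : (ν.real Set.univ : ℂ) = ∫ _ : ℝ, (1 : ℂ) ∂ν := by simp
  rw [hfun, h0]
  refine tendsto_integral_filter_of_dominated_convergence (fun _ => 1)
    (Eventually.of_forall fun y => Measurable.aestronglyMeasurable (by fun_prop))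
    ?_ (integrable_const _) (ae_of_all _ fun s => ?_)
  · filter_upwards [eventually_gt_atTop 0] with y hy
    refine ae_of_all _ fun s => ?_
    have h1 := le_norm_ofReal_mul_I_sub y s
    rw [norm_mul, norm_ofReal_mul_I hy, norm_inv, ← div_eq_mul_inv]
    exact div_le_one_of_le₀ h1 (norm_nonneg _)
  · have h1 := ((tendsto_inv_ofReal_mul_I_sub s).const_mul (s : ℂ)).const_add 1
    rw [mul_zero, add_zero] at h1
    refine h1.congr' ?_
    filter_upwards [eventually_gt_atTop 0] with y hy
    have := ofReal_mul_I_sub_ne_zero hy s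
    field_simp
    ring

/-- If b > 0 the linear term contributes by²/π. If the mass is infinite, y times the Poisson
integral is ∫ y²/‖iy − s‖² dν, which diverges by Fatou's lemma. -/
lemma tendsto_mul_re_nevanlinna_atTop {ν : Measure ℝ} (hν : MemM2 ν) (a : ℝ) {b : ℝ} (hb : 0 ≤ b)
    (h : b ≠ 0 ∨ ν Set.univ = ⊤) :
    Tendsto (fun y : ℝ => y * (nevanlinna ν a b (y * Complex.I)).re) atTop atTop := by
  have hpi := Real.pi_pos
  rcases h with h | h
  · have hb' : 0 < b := lt_of_le_of_ne hb h.symm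
    refine tendsto_atTop_mono' _ ?_ ((tendsto_id (α := ℝ)).const_mul_atTop
      (by positivity : 0 < Real.pi⁻¹ * b))
    filter_upwards [eventually_ge_atTop 1] with y hy
    rw [re_nevanlinna hν a b (by rw [ofReal_mul_I_im]; linarith), ofReal_mul_I_im, id]
    have h1 : 0 ≤ (poissonInt ν (y * Complex.I)).toReal := ENNReal.toReal_nonneg
    have h2 : Real.pi⁻¹ * b * y ≤ Real.pi⁻¹ * ((poissonInt ν (y * Complex.I)).toReal + b * y) := by
      rw [mul_assoc]; gcongr; linarith
    refine h2.trans (le_mul_of_one_le_left (by positivity) hy)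
  · have h1 : Tendsto (fun y : ℝ => ∫⁻ s : ℝ,
        ENNReal.ofReal (y ^ 2 / ‖(y : ℂ) * Complex.I - s‖ ^ 2) ∂ν) atTop (𝓝 ⊤) := by
      refine tendsto_lintegral_top (g := fun _ => 1) (fun y => by fun_prop) (fun s => ?_)
        (by simpa using h)
      have h2 := ((tendsto_inv_ofReal_mul_I_sub s).const_mul (s : ℂ)).const_add 1
      have h3 := (h2.norm.pow 2)
      rw [mul_zero, add_zero, norm_one, one_pow] at h3
      have h4 := ENNReal.tendsto_ofReal h3
      rw [ENNReal.ofReal_one] at h4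
      refine h4.congr' ?_
      filter_upwards [eventually_gt_atTop 0] with y hy
      have h5 := ofReal_mul_I_sub_ne_zero hy s
      rw [show 1 + (s : ℂ) * ((y : ℂ) * Complex.I - s)⁻¹
        = (y : ℂ) * Complex.I / ((y : ℂ) * Complex.I - s) by field_simp; ring, norm_div,
        norm_ofReal_mul_I hy, div_pow]
    refine tendsto_atTop.2 fun M => ?_
    filter_upwards [eventually_gt_atTop 0, h1.eventually
      (lt_mem_nhds (ENNReal.ofReal_lt_top (r := Real.pi * M)))] with y hy hy2
    have him : 0 < ((y : ℂ) * Complex.I).im := by rwa [ofReal_mul_I_im]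
    have h3 : ENNReal.ofReal (Real.pi * M) ≤ ENNReal.ofReal y * poissonInt ν (y * Complex.I) := by
      refine hy2.le.trans (le_of_eq ?_)
      rw [poissonInt, ← lintegral_const_mul _ (measurable_poissonKernel _)]
      refine lintegral_congr fun s => ?_
      rw [ofReal_mul_I_im, ← ENNReal.ofReal_mul hy.le]
      congr 1
      ring
    have h4 := (ENNReal.ofReal_le_iff_le_toReal (ENNReal.mul_lt_top ENNReal.ofReal_lt_top
      (poissonInt_lt_top hν him)).ne).1 h3
    rw [ENNReal.toReal_mul, ENNReal.toReal_ofReal hy.le] at h4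
    rw [re_nevanlinna hν a b him, ofReal_mul_I_im]
    calc M = Real.pi⁻¹ * (Real.pi * M) := by field_simp
      _ ≤ Real.pi⁻¹ * (y * ((poissonInt ν (y * Complex.I)).toReal + b * y)) := by
        refine mul_le_mul_of_nonneg_left ?_ (by positivity)
        nlinarith [mul_nonneg hb (mul_nonneg hy.le hy.le)]
      _ = _ := by ring

/-! ### The constants of the dual triple -/

section Dual

variable {lam μ : Measure ℝ} {c₀ c₁ a b : ℝ}

lemma eq_of_tendsto_neg_I_mul {x y : ℝ} {f : ℝ → ℂ}
    (h1 : Tendsto f atTop (𝓝 (-(Complex.I / Real.pi) * x)))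
    (h2 : Tendsto f atTop (𝓝 (-(Complex.I / Real.pi) * y))) : x = y := by
  have hpi' : (Real.pi : ℂ) ≠ 0 := by exact_mod_cast Real.pi_ne_zero
  exact_mod_cast mul_left_cancel₀ (neg_ne_zero.2 (div_ne_zero Complex.I_ne_zero hpi'))
    (tendsto_nhds_unique h1 h2)

/-- G(iy)/(iy) = (iy F(iy))⁻¹, and iy F(iy) → (i/π)‖λ‖ once the constant cancels. -/
lemma dual_slope_eq (hμ : MemM2 μ) [IsFiniteMeasure lam] (hlam0 : lam ≠ 0)
    (hFG : ∀ z : ℂ, 0 < z.im → nevanlinna lam c₀ 0 z * nevanlinna μ a b z = 1)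
    (h : c₀ = ∫ s : ℝ, s / (1 + s ^ 2) ∂lam) : b = Real.pi ^ 2 / lam.real Set.univ := by
  have hpi' : (Real.pi : ℂ) ≠ 0 := by exact_mod_cast Real.pi_ne_zero
  have hm : 0 < lam.real Set.univ := by
    rw [measureReal_def]
    exact ENNReal.toReal_pos (by simpa using hlam0) (measure_ne_top _ _)
  have hm' : (lam.real Set.univ : ℂ) ≠ 0 := by exact_mod_cast hm.ne'
  refine eq_of_tendsto_neg_I_mul (tendsto_nevanlinna_div_atTop hμ a b) ?_
  have h1 := ((tendsto_mul_integral_inv_ofReal_mul_I_sub lam).const_mul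
    (Complex.I / (Real.pi : ℂ))).inv₀ (mul_ne_zero (div_ne_zero Complex.I_ne_zero hpi') hm')
  have h2 : (Complex.I / (Real.pi : ℂ) * (lam.real Set.univ : ℂ))⁻¹
      = -(Complex.I / Real.pi) * ((Real.pi ^ 2 / lam.real Set.univ : ℝ) : ℂ) := by
    have hI : Complex.I ^ 2 = -1 := Complex.I_sq
    have hI0 := Complex.I_ne_zero
    push_cast
    field_simp
    linear_combination hI
  rw [h2] at h1
  refine h1.congr' ?_
  filter_upwards [eventually_gt_atTop 0] with y hy
  have h3 := hFG (y * Complex.I) (by rwa [ofReal_mul_I_im])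
  rw [nevanlinna_eq_of_isFiniteMeasure lam c₀ hy, ← h, sub_self, Complex.ofReal_zero,
    add_zero] at h3
  have h4 := left_ne_zero_of_mul_eq_one h3
  rw [eq_div_iff (mul_ne_zero (by exact_mod_cast hy.ne') Complex.I_ne_zero),
    eq_comm, ← inv_eq_of_mul_eq_one_right h3]
  have hy' : (y : ℂ) * Complex.I ≠ 0 := mul_ne_zero (by exact_mod_cast hy.ne') Complex.I_ne_zero
  rw [mul_left_comm (Complex.I / (Real.pi : ℂ)), mul_inv ((y : ℂ) * Complex.I),
    mul_comm ((y : ℂ) * Complex.I)⁻¹, inv_mul_cancel_right₀ hy']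

/-- It suffices that |y F(iy)| → ∞. Either y Re F(iy) already diverges, or λ is finite with c₁ = 0
and F(iy) tends to a nonzero imaginary constant. -/
lemma dual_slope_eq_zero (hlam : MemM2 lam) (hμ : MemM2 μ) (hc₁ : 0 ≤ c₁)
    (hFG : ∀ z : ℂ, 0 < z.im → nevanlinna lam c₀ c₁ z * nevanlinna μ a b z = 1)
    (h : ¬ (c₁ = 0 ∧ lam Set.univ < ⊤ ∧ c₀ = ∫ s : ℝ, s / (1 + s ^ 2) ∂lam)) : b = 0 := by
  have hpi' : (Real.pi : ℂ) ≠ 0 := by exact_mod_cast Real.pi_ne_zero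
  refine eq_of_tendsto_neg_I_mul (tendsto_nevanlinna_div_atTop hμ a b) ?_
  rw [Complex.ofReal_zero, mul_zero]
  by_cases hcase : c₁ ≠ 0 ∨ lam Set.univ = ⊤
  · have h1 := tendsto_mul_re_nevanlinna_atTop hlam c₀ hc₁ hcase
    refine squeeze_zero_norm' ?_ h1.inv_tendsto_atTop
    filter_upwards [eventually_gt_atTop 0, h1.eventually_gt_atTop 0] with y hy hy2
    have h3 := hFG (y * Complex.I) (by rwa [ofReal_mul_I_im])
    rw [← inv_eq_of_mul_eq_one_right h3, norm_div, norm_inv, norm_ofReal_mul_I hy,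
      div_eq_mul_inv, ← mul_inv, Pi.inv_apply]
    refine inv_anti₀ hy2 ?_
    rw [mul_comm]
    gcongr
    exact Complex.re_le_norm _
  · rw [not_or, not_not] at hcase
    obtain ⟨rfl, hfin⟩ := hcase
    have : IsFiniteMeasure lam := ⟨lt_top_iff_ne_top.2 hfin⟩
    have hne : (∫ s : ℝ, s / (1 + s ^ 2) ∂lam) - c₀ ≠ 0 := fun h0 =>
      h ⟨rfl, measure_lt_top _ _, by linarith⟩
    have hne' : (((∫ s : ℝ, s / (1 + s ^ 2) ∂lam) - c₀ : ℝ) : ℂ) ≠ 0 := by exact_mod_cast hne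
    have h0 : Tendsto (fun y : ℝ => ∫ s : ℝ, ((y : ℂ) * Complex.I - s)⁻¹ ∂lam) atTop (𝓝 0) := by
      have := (tendsto_mul_integral_inv_ofReal_mul_I_sub lam).mul tendsto_inv_ofReal_mul_I
      rw [mul_zero] at this
      refine this.congr' ?_
      filter_upwards [eventually_gt_atTop 0] with y hy
      have hy' : (y : ℂ) * Complex.I ≠ 0 :=
        mul_ne_zero (by exact_mod_cast hy.ne') Complex.I_ne_zero
      rw [mul_comm, inv_mul_cancel_left₀ hy']
    have h1 := (h0.add_const (((∫ s : ℝ, s / (1 + s ^ 2) ∂lam) - c₀ : ℝ) : ℂ)).const_mul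
      (Complex.I / (Real.pi : ℂ))
    rw [zero_add] at h1
    have h2 := (h1.inv₀ (mul_ne_zero (div_ne_zero Complex.I_ne_zero hpi') hne')).mul
      tendsto_inv_ofReal_mul_I
    rw [mul_zero] at h2
    refine h2.congr' ?_
    filter_upwards [eventually_gt_atTop 0] with y hy
    have h3 := hFG (y * Complex.I) (by rwa [ofReal_mul_I_im])
    rw [← nevanlinna_eq_of_isFiniteMeasure lam c₀ hy, inv_eq_of_mul_eq_one_right h3,
      div_eq_mul_inv]

lemma cauchyReg_I (ν : Measure ℝ) :
    cauchyReg ν Complex.I = ((Real.pi⁻¹ * ∫ s : ℝ, (1 + s ^ 2)⁻¹ ∂ν : ℝ) : ℂ) := by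
  rw [← integral_const_mul, ← integral_complex_ofReal]
  refine integral_congr_ae (ae_of_all _ fun s => ?_)
  have h1 := one_add_sq_ne_zero s
  have h2 : Complex.I - s ≠ 0 := sub_ofReal_ne_zero (by simp) s
  have hpi' : (Real.pi : ℂ) ≠ 0 := by exact_mod_cast Real.pi_ne_zero
  have hI : Complex.I ^ 2 = -1 := Complex.I_sq
  push_cast
  change regKernel Complex.I s = _
  rw [regKernel_eq h2]
  field_simp
  linear_combination (s : ℂ) * hI

/-- At z = i both the Cauchy integral and the linear term are real, so Im G(i) = −π⁻¹ζ₀. -/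
lemma dual_const_eq
    (hFG : ∀ z : ℂ, 0 < z.im → nevanlinna lam c₀ c₁ z * nevanlinna μ a b z = 1) :
    a = -Real.pi ^ 2 *
      ((((∫ s : ℝ, (1 + s ^ 2)⁻¹ ∂lam : ℝ) : ℂ) + c₁ - Complex.I * c₀)⁻¹).im := by
  have hpi' : (Real.pi : ℂ) ≠ 0 := by exact_mod_cast Real.pi_ne_zero
  have h := hFG Complex.I (by simp)
  have hI : Complex.I ^ 2 = -1 := Complex.I_sq
  have h1 : nevanlinna lam c₀ c₁ Complex.I = ((Real.pi⁻¹ : ℝ) : ℂ) *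
      (((∫ s : ℝ, (1 + s ^ 2)⁻¹ ∂lam : ℝ) : ℂ) + c₁ - Complex.I * c₀) := by
    rw [nevanlinna, cauchyReg_I]
    push_cast
    linear_combination (-(Real.pi : ℂ)⁻¹ * c₁) * hI
  have h2 : (nevanlinna μ a b Complex.I).im = -(Real.pi⁻¹ * a) := by
    rw [nevanlinna, cauchyReg_I, Complex.sub_im, Complex.ofReal_im, mul_assoc, Complex.I_mul_im,
      ← Complex.ofReal_inv, Complex.re_ofReal_mul]
    simp
  rw [← inv_eq_of_mul_eq_one_right h, h1, mul_inv, ← Complex.ofReal_inv, inv_inv,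
    Complex.im_ofReal_mul] at h2
  have hpi := Real.pi_ne_zero
  field_simp at h2 ⊢
  linarith

end Dual

/-! ### Radial limits on the circle and boundary values on the line -/

lemma norm_ofReal_mul_circle_lt_one {r : ℝ} (hr : r ∈ Set.Ioo (0 : ℝ) 1) (w : Circle) :
    ‖(r : ℂ) * (w : ℂ)‖ < 1 := by
  rw [norm_mul, Circle.norm_coe, mul_one, Complex.norm_real, Real.norm_of_nonneg hr.1.le]
  exact hr.2

lemma im_nevanlinna (ν : Measure ℝ) (a b : ℝ) (z : ℂ) :
    (nevanlinna ν a b z).im = (cauchyReg ν z).im - Real.pi⁻¹ * (b * z.re + a) := by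
  rw [nevanlinna, Complex.sub_im, mul_assoc, Complex.I_mul_im, ← Complex.ofReal_inv,
    Complex.re_ofReal_mul]
  simp
  ring

/-- The linear term converges along the curve, so it can be moved across the limit. The Hilbert
condition in `atomSet` thus says Im F → 0 along the image of the radius. -/
lemma hasHilbertReg_iff (ν : Measure ℝ) (a b s h : ℝ) :
    HasHilbertReg ν s h ↔
      Tendsto (fun r : ℝ => (nevanlinna ν a b (cayleyPlane (r * (cayleyInv s : ℂ)))).im) (𝓝[<] 1)
        (𝓝 (h - Real.pi⁻¹ * (b * s + a))) := by
  have hev : ∀ᶠ r : ℝ in 𝓝[<] 1, (cauchyCircle (psi ν) (r * (cayleyInv s : ℂ))).im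
      = (cauchyReg ν (cayleyPlane (r * (cayleyInv s : ℂ)))).im := by
    filter_upwards [Ioo_mem_nhdsLT (zero_lt_one' ℝ)] with r hr
    have h1 := norm_ofReal_mul_circle_lt_one hr (cayleyInv s)
    rw [cauchyReg_eq_cauchyCircle ν (im_cayleyPlane_pos h1),
      cayleyDisc_cayleyPlane (one_add_ne_zero_of_norm_lt h1)]
  have hre : Tendsto (fun r : ℝ =>
      Real.pi⁻¹ * (b * (cayleyPlane (r * (cayleyInv s : ℂ))).re + a)) (𝓝[<] 1)
      (𝓝 (Real.pi⁻¹ * (b * s + a))) := by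
    have h1 := (Complex.continuous_re.tendsto _).comp
      ((tendsto_radial_coneFilter s).mono_right (coneFilter_le_nhds s))
    exact ((h1.const_mul b).add_const a).const_mul _
  simp only [im_nevanlinna]
  rw [HasHilbertReg, HasHilbertCircle, tendsto_congr' hev]
  refine ⟨fun h1 => h1.sub hre, fun h1 => ?_⟩
  have := h1.add hre
  simpa using this

lemma HasHilbertReg.hilbertReg_eq {ν : Measure ℝ} {s h : ℝ} (hh : HasHilbertReg ν s h) :
    hilbertReg ν s = h :=
  Tendsto.limUnder_eq hh

lemma hasHilbertCircle_psiReg {ν : Measure ℝ} (hν : MemM2 ν) (a : ℝ) {b : ℝ} (hb : 0 ≤ b) {s : ℝ}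
    (h : HasHilbertReg ν s (Real.pi⁻¹ * (b * s + a))) :
    HasHilbertCircle (psiReg ν a b).1 (cayleyInv s) (-(psiReg ν a b).2) := by
  have h1 := ((hasHilbertReg_iff ν a b s _).1 h).add_const (Real.pi⁻¹ * a)
  rw [sub_self, zero_add] at h1
  have h2 : -(psiReg ν a b).2 = Real.pi⁻¹ * a := neg_neg _
  rw [HasHilbertCircle, h2]
  refine h1.congr' ?_
  filter_upwards [Ioo_mem_nhdsLT (zero_lt_one' ℝ)] with r hr
  rw [cauchyCircle_psiReg hν a hb (norm_ofReal_mul_circle_lt_one hr (cayleyInv s)),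
    Complex.add_im, Complex.I_mul_im, Complex.ofReal_re]

/-! ### Zero sets -/

lemma norm_coe_sub_le_of_mem_circleArc {w w' : Circle} {δ : ℝ} (h : w' ∈ circleArc w δ) :
    ‖(w' : ℂ) - w‖ ≤ δ := by
  obtain ⟨t, ht, rfl⟩ := h
  have h1 : ((w * Circle.exp t : Circle) : ℂ) - w = w * (Complex.exp (Complex.I * t) - 1) := by
    rw [Circle.coe_mul, Circle.coe_exp, mul_comm (t : ℂ)]
    ring
  have h2 := Real.norm_exp_I_mul_ofReal_sub_one_le (x := t)
  rw [h1, norm_mul, Circle.norm_coe, one_mul]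
  exact h2.trans (abs_le.2 ht)

lemma measurableSet_circleArc (w : Circle) (δ : ℝ) : MeasurableSet (circleArc w δ) := by
  have hc : Continuous fun t : ℝ => w * Circle.exp t := by fun_prop
  exact (isCompact_Icc.image hc).isClosed.measurableSet

lemma normSq_I_add (s : ℝ) : ‖Complex.I + (s : ℂ)‖ ^ 2 = 1 + s ^ 2 := by
  rw [← Complex.normSq_eq_norm_sq]
  simp [Complex.normSq_apply]
  ring

/-- The chord is 2|t − s|/(‖i + t‖‖i + s‖). With A = ‖i + s‖ this gives 2|t − s| ≤ δA² + δA|t − s|,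
and δA ≤ 1 absorbs the last term. -/
lemma abs_sub_le_of_norm_cayleyInv_sub_le {s t δ : ℝ} (hδ : δ * (1 + s ^ 2) ≤ 1 / 2) (hδ0 : 0 ≤ δ)
    (h : ‖(cayleyInv t : ℂ) - cayleyInv s‖ ≤ δ) : |t - s| ≤ δ * (1 + s ^ 2) := by
  have h1 := I_add_ne_zero (z := s) (by simp)
  have h2 := I_add_ne_zero (z := t) (by simp)
  have h3 : (cayleyInv t : ℂ) - cayleyInv s
      = 2 * Complex.I * ((s - t : ℝ) : ℂ) / ((Complex.I + t) * (Complex.I + s)) := by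
    rw [coe_cayleyInv, coe_cayleyInv, cayleyDisc, cayleyDisc, div_sub_div _ _ h2 h1]
    congr 1
    push_cast
    ring
  rw [h3, norm_div, norm_mul, norm_mul, norm_mul, Complex.norm_I, Complex.norm_two,
    Complex.norm_real, Real.norm_eq_abs, abs_sub_comm,
    div_le_iff₀ (mul_pos (norm_pos_iff.2 h2) (norm_pos_iff.2 h1))] at h
  have h4 : ‖Complex.I + (t : ℂ)‖ ≤ ‖Complex.I + (s : ℂ)‖ + |t - s| := by
    rw [show Complex.I + (t : ℂ) = (Complex.I + s) + ((t - s : ℝ) : ℂ) by push_cast; ring]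
    refine (norm_add_le _ _).trans ?_
    rw [Complex.norm_real, Real.norm_eq_abs]
  have h5 := normSq_I_add s
  set A := ‖Complex.I + (s : ℂ)‖
  have hA : 0 ≤ A := norm_nonneg _
  have hA1 : 1 ≤ A := by nlinarith [sq_nonneg s]
  have h6 : δ * A ≤ 1 := by nlinarith
  have h7 : δ * (‖Complex.I + (t : ℂ)‖ * A) ≤ δ * ((A + |t - s|) * A) := by gcongr
  rw [← h5]
  nlinarith [mul_le_mul_of_nonneg_right h6 (abs_nonneg (t - s))]

/-- The arc pulls back into an interval longer by the factor 1 + s², where the density of `psi` is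
at most (1 + s²)⁻¹: the factors cancel and the same ε works on both sides. The factor π⁻¹ absorbs
the variation of 1 + t²; small δ keeps −1 off the arc. -/
lemma psiReg_circleArc_div_le (ν : Measure ℝ) (a b : ℝ) {s δ : ℝ} (hδ0 : 0 < δ)
    (hδ : δ * (1 + s ^ 2) ≤ 1 / 2) (hδ' : δ < ‖1 + (cayleyInv s : ℂ)‖) :
    (psiReg ν a b).1 (circleArc (cayleyInv s) δ) / ENNReal.ofReal (2 * δ)
      ≤ ν (Set.Icc (s - (1 + s ^ 2) * δ) (s + (1 + s ^ 2) * δ))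
        / ENNReal.ofReal (2 * ((1 + s ^ 2) * δ)) := by
  have hK : 0 < 1 + s ^ 2 := by positivity
  have hpi := Real.pi_pos
  have hm := measurableSet_circleArc (cayleyInv s) δ
  have hsub : cayleyInv ⁻¹' circleArc (cayleyInv s) δ
      ⊆ Set.Icc (s - (1 + s ^ 2) * δ) (s + (1 + s ^ 2) * δ) := by
    intro t ht
    have h1 := abs_sub_le_of_norm_cayleyInv_sub_le hδ hδ0.le (norm_coe_sub_le_of_mem_circleArc ht)
    rw [abs_le] at h1
    constructor <;> linarith
  have hnot : (-1 : Circle) ∉ circleArc (cayleyInv s) δ := by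
    intro h
    have h1 := norm_coe_sub_le_of_mem_circleArc h
    rw [Circle.coe_neg, Circle.coe_one, ← norm_neg, neg_sub, sub_neg_eq_add, add_comm] at h1
    linarith
  have hpsi : psi ν (circleArc (cayleyInv s) δ) ≤ ENNReal.ofReal ((1 + s ^ 2)⁻¹)
      * ν (Set.Icc (s - (1 + s ^ 2) * δ) (s + (1 + s ^ 2) * δ)) := by
    rw [psi, Measure.map_apply continuous_cayleyInv.measurable hm]
    refine (measure_mono hsub).trans ?_
    rw [withDensity_apply _ measurableSet_Icc, ← setLIntegral_const]
    refine setLIntegral_mono' measurableSet_Icc fun t ht => ENNReal.ofReal_le_ofReal ?_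
    refine inv_anti₀ hK ?_
    have h1 : |t - s| ≤ 1 / 2 := abs_le.2 ⟨by linarith [ht.1], by linarith [ht.2]⟩
    have h2 : (t - s) ^ 2 ≤ 1 / 4 := by
      rw [← sq_abs]; nlinarith [abs_nonneg (t - s)]
    nlinarith [Real.pi_gt_three, sq_nonneg t, sq_nonneg (s - 2 * t)]
  have htot : (psiReg ν a b).1 (circleArc (cayleyInv s) δ) = psi ν (circleArc (cayleyInv s) δ) := by
    rw [psiReg, Measure.add_apply, Measure.smul_apply, Measure.dirac_apply' _ hm,
      Set.indicator_of_notMem hnot, smul_zero, add_zero]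
  rw [htot]
  refine (ENNReal.div_le_div_right hpsi _).trans (le_of_eq ?_)
  rw [show 2 * ((1 + s ^ 2) * δ) = (1 + s ^ 2) * (2 * δ) by ring, ENNReal.ofReal_mul hK.le,
    ENNReal.ofReal_inv_of_pos hK, ENNReal.div_eq_inv_mul, ENNReal.div_eq_inv_mul,
    ENNReal.mul_inv (Or.inl (by simpa using hK)) (Or.inl ENNReal.ofReal_ne_top)]
  ring

lemma cayleyInv_mem_zeroSetCircle (ν : Measure ℝ) (a b : ℝ) {s : ℝ} (hs : s ∈ zeroSetLine ν) :
    cayleyInv s ∈ zeroSetCircle (psiReg ν a b).1 := by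
  simp only [zeroSetLine, zeroSetCircle, Set.mem_iInter] at hs ⊢
  intro ε hε
  refine closure_mono ?_ (image_closure_subset_closure_image continuous_cayleyInv
    (Set.mem_image_of_mem _ (hs ε hε)))
  rintro _ ⟨t, ht, rfl⟩
  rw [Set.mem_ofPred_eq] at ht ⊢
  refine lt_of_le_of_lt ?_ ht
  have hK : 0 < 1 + t ^ 2 := by positivity
  have htend : Tendsto (fun δ : ℝ => (1 + t ^ 2) * δ) (𝓝[>] 0) (𝓝[>] 0) := by
    refine tendsto_nhdsWithin_iff.2 ⟨?_, ?_⟩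
    · have : Continuous fun δ : ℝ => (1 + t ^ 2) * δ := by fun_prop
      simpa using (this.tendsto 0).mono_left nhdsWithin_le_nhds
    · filter_upwards [self_mem_nhdsWithin] with δ hδ
      exact mul_pos hK hδ
  have hev : ∀ᶠ δ : ℝ in 𝓝[>] 0,
      (psiReg ν a b).1 (circleArc (cayleyInv t) δ) / ENNReal.ofReal (2 * δ)
      ≤ ν (Set.Icc (t - (1 + t ^ 2) * δ) (t + (1 + t ^ 2) * δ))
        / ENNReal.ofReal (2 * ((1 + t ^ 2) * δ)) := by
    have h1 : 0 < ‖1 + (cayleyInv t : ℂ)‖ := norm_pos_iff.2 (one_add_cayleyInv_ne_zero t)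
    filter_upwards [self_mem_nhdsWithin, Ioo_mem_nhdsGT h1,
      Ioo_mem_nhdsGT (show 0 < 1 / 2 / (1 + t ^ 2) by positivity)] with δ hδ h2 h3
    refine psiReg_circleArc_div_le ν a b hδ ?_ h2.2
    exact ((lt_div_iff₀ hK).1 h3.2).le
  refine (limsup_le_limsup hev).trans ?_
  exact limsup_le_limsup_of_le (f := map (fun δ : ℝ => (1 + t ^ 2) * δ) (𝓝[>] 0))
    (u := fun δ : ℝ => ν (Set.Icc (t - δ) (t + δ)) / ENNReal.ofReal (2 * δ)) htend

/-- On the support the zero-set condition is used, off the support the Hilbert condition. -/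
lemma cayleyInv_mem_criticalSetCircle {ν : Measure ℝ} (hν : MemM2 ν) (a : ℝ) {b : ℝ} (hb : 0 ≤ b)
    {s : ℝ} (hs : s ∈ atomSet ν a b) : cayleyInv s ∈ criticalSetCircle ν a b := by
  by_cases h : cayleyInv s ∈ (psiReg ν a b).1.support
  · exact Or.inl ⟨cayleyInv_mem_zeroSetCircle ν a b hs.1, h⟩
  · exact Or.inr ⟨h, hasHilbertCircle_psiReg hν a hb hs.2⟩

lemma IsDiscreteSubset.countable {S : Set Circle} (hS : IsDiscreteSubset S) : S.Countable := by
  have : DiscreteTopology S := by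
    rw [discreteTopology_iff_isOpen_singleton]
    intro x
    rw [Metric.isOpen_singleton_iff]
    obtain ⟨ε, hε, h⟩ := hS x x.2
    refine ⟨ε, hε, fun y hy => ?_⟩
    by_contra hne
    have h1 := h y y.2 fun h2 => hne (Subtype.ext h2)
    rw [dist_comm] at h1
    exact absurd hy (not_lt.2 h1.le)
  exact Set.countable_coe_iff.1 countable_of_Lindelof_of_discrete

/-- The sole use of discreteness. Countability is what excludes a singular continuous part of μ. -/
lemma atomSet_countable {ν : Measure ℝ} (hν : MemM2 ν) {a b : ℝ} (hb : 0 ≤ b)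
    (hZ : IsDiscreteSubset (criticalSetCircle ν a b)) : (atomSet ν a b).Countable := by
  refine (hZ.countable.preimage_of_injOn cayleyInv_injective.injOn).mono fun s hs => ?_
  exact cayleyInv_mem_criticalSetCircle hν a hb hs

lemma mem_zeroSetLine_of_tendsto {ν : Measure ℝ} {s : ℝ}
    (h : Tendsto (poissonInt ν) (coneFilter s) (𝓝 0)) : s ∈ zeroSetLine ν := by
  have hlim : Tendsto (fun δ : ℝ => ν (Set.Icc (s - δ) (s + δ)) / ENNReal.ofReal (2 * δ)) (𝓝[>] 0)
      (𝓝 0) := by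
    have h1 := ENNReal.Tendsto.const_mul (h.comp (tendsto_vertical_coneFilter s))
      (a := ENNReal.ofReal (9 / 2)) (Or.inr ENNReal.ofReal_ne_top)
    rw [mul_zero] at h1
    refine tendsto_of_tendsto_of_tendsto_of_le_of_le' tendsto_const_nhds h1
      (Eventually.of_forall fun _ => zero_le) ?_
    filter_upwards [self_mem_nhdsWithin,
      (tendsto_vertical_coneFilter s).eventually (eventually_cone s)] with δ hδ hz
    have hδ0 : 0 < δ := hδ
    have h2 := ofReal_inv_mul_measure_le_poissonInt ν hz.1 hz.2
    have h3 : ((s : ℂ) + δ * Complex.I).im = δ := by simp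
    rw [h3, Real.closedBall_eq_Icc] at h2
    refine le_trans (le_of_eq ?_) (mul_le_mul_right h2 (ENNReal.ofReal (9 / 2)))
    rw [← mul_assoc, ← ENNReal.ofReal_mul (by norm_num), ENNReal.div_eq_inv_mul,
      ← ENNReal.ofReal_inv_of_pos (by positivity)]
    congr 2
    field_simp
  simp only [zeroSetLine, Set.mem_iInter]
  intro ε hε
  refine subset_closure ?_
  rw [Set.mem_ofPred_eq, hlim.limsup_eq]
  exact ENNReal.ofReal_pos.2 hε

/-! ### The dual measure -/

section Dual

variable {lam μ : Measure ℝ} {c₀ c₁ a b : ℝ}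

lemma mem_atomSet_of_tendsto (hlam : MemM2 lam) (hc₁ : 0 ≤ c₁) {s : ℝ}
    (h : Tendsto (nevanlinna lam c₀ c₁) (coneFilter s) (𝓝 0)) : s ∈ atomSet lam c₀ c₁ := by
  constructor
  · apply mem_zeroSetLine_of_tendsto
    have h1 := ((Complex.continuous_re.tendsto _).comp h).const_mul Real.pi
    rw [Complex.zero_re, mul_zero] at h1
    have h2 := ENNReal.tendsto_ofReal h1
    rw [ENNReal.ofReal_zero] at h2
    refine tendsto_of_tendsto_of_tendsto_of_le_of_le' tendsto_const_nhds h2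
      (Eventually.of_forall fun _ => zero_le) ?_
    filter_upwards [eventually_cone s] with z hz
    have hz0 := hz.1
    rw [Function.comp_apply, re_nevanlinna hlam c₀ c₁ hz.1, mul_inv_cancel_left₀ Real.pi_ne_zero]
    refine (ENNReal.ofReal_toReal (poissonInt_lt_top hlam hz.1).ne).symm.le.trans ?_
    refine ENNReal.ofReal_le_ofReal ?_
    have : 0 ≤ c₁ * z.im := by positivity
    linarith
  · refine (hasHilbertReg_iff lam c₀ c₁ s _).2 ?_
    rw [sub_self]
    have h1 := (Complex.continuous_im.tendsto _).comp (h.comp (tendsto_radial_coneFilter s))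
    simpa [Function.comp_def] using h1

lemma ae_singularPart_mem_atomSet (hlam : MemM2 lam) (hc₁ : 0 ≤ c₁) (hμ : MemM2 μ) (hb : 0 ≤ b)
    (hFG : ∀ z : ℂ, 0 < z.im → nevanlinna lam c₀ c₁ z * nevanlinna μ a b z = 1) :
    ∀ᵐ s ∂(μ.singularPart volume), s ∈ atomSet lam c₀ c₁ := by
  filter_upwards [ae_singularPart_tendsto_poissonInt hμ] with s hs
  refine mem_atomSet_of_tendsto hlam hc₁ ?_
  have hpi := Real.pi_pos
  have hre : Tendsto (fun z => (nevanlinna μ a b z).re) (coneFilter s) atTop := by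
    refine tendsto_atTop.2 fun M => ?_
    filter_upwards [eventually_cone s, hs.eventually
      (lt_mem_nhds (ENNReal.ofReal_lt_top (r := Real.pi * M)))] with z hz hz2
    have h1 := (ENNReal.ofReal_le_iff_le_toReal (poissonInt_lt_top hμ hz.1).ne).1 hz2.le
    have h2 : 0 ≤ b * z.im := mul_nonneg hb hz.1.le
    rw [re_nevanlinna hμ a b hz.1]
    calc M = Real.pi⁻¹ * (Real.pi * M) := by field_simp
      _ ≤ _ := by
        refine mul_le_mul_of_nonneg_left ?_ (by positivity)
        linarith
  refine squeeze_zero_norm' ?_ hre.inv_tendsto_atTop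
  filter_upwards [eventually_cone s, hre.eventually_gt_atTop 0] with z hz hz2
  rw [← inv_eq_of_mul_eq_one_left (hFG z hz.1), norm_inv, Pi.inv_apply]
  exact inv_anti₀ hz2 (Complex.re_le_norm _)

lemma re_nevanlinna_pos (hlam : MemM2 lam) (hlam0 : lam ≠ 0) (c₀ : ℝ) (hc₁ : 0 ≤ c₁) {z : ℂ}
    (hz : 0 < z.im) : 0 < (nevanlinna lam c₀ c₁ z).re := by
  rw [re_nevanlinna hlam c₀ c₁ hz]
  have h1 := ENNReal.toReal_pos (poissonInt_pos hlam0 hz).ne' (poissonInt_lt_top hlam hz).ne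
  have h2 : 0 ≤ c₁ * z.im := mul_nonneg hc₁ hz.le
  have := Real.pi_pos
  positivity

lemma re_inv_pos {w : ℂ} (h : 0 < w.re) : 0 < (w⁻¹).re := by
  have h0 : w ≠ 0 := fun h' => by simp [h'] at h
  rw [Complex.inv_re]
  exact div_pos h (Complex.normSq_pos.2 h0)

/-- F and G have limits L and L' with LL' = 1. So L ≠ 0, the denominator does not vanish, and Re L'
= Re L/|L|². -/
lemma ae_boundary_values (hlam : MemM2 lam) (hlam0 : lam ≠ 0) (hc₁ : 0 ≤ c₁) (hμ : MemM2 μ)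
    (hFG : ∀ z : ℂ, 0 < z.im → nevanlinna lam c₀ c₁ z * nevanlinna μ a b z = 1) :
    ∀ᵐ s : ℝ, HasHilbertReg lam s (hilbertReg lam s) ∧
      acDensity μ s = acDensity lam s /
        (acDensity lam s ^ 2 + (hilbertReg lam s - Real.pi⁻¹ * (c₁ * s + c₀)) ^ 2) := by
  have hpos : ∀ z : ℂ, 0 < z.im → 0 < (nevanlinna lam c₀ c₁ z).re := fun z hz =>
    re_nevanlinna_pos hlam hlam0 c₀ hc₁ hz
  have hposG : ∀ z : ℂ, 0 < z.im → 0 < (nevanlinna μ a b z).re := fun z hz => by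
    rw [← inv_eq_of_mul_eq_one_right (hFG z hz)]
    exact re_inv_pos (hpos z hz)
  filter_upwards [ae_exists_tendsto_of_re_pos (differentiableOn_nevanlinna hlam c₀ c₁) hpos,
    ae_exists_tendsto_of_re_pos (differentiableOn_nevanlinna hμ a b) hposG,
    ae_tendsto_re_nevanlinna hlam c₀ c₁, ae_tendsto_re_nevanlinna hμ a b]
    with s ⟨L, hL⟩ ⟨L', hL'⟩ h1 h2
  have hLL : L * L' = 1 := tendsto_nhds_unique (hL.mul hL')
    (tendsto_const_nhds.congr' ((eventually_cone s).mono fun z hz => (hFG z hz.1).symm))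
  have hre : L.re = acDensity lam s :=
    tendsto_nhds_unique ((Complex.continuous_re.tendsto _).comp hL) h1
  have hre' : L'.re = acDensity μ s :=
    tendsto_nhds_unique ((Complex.continuous_re.tendsto _).comp hL') h2
  have hH : HasHilbertReg lam s (L.im + Real.pi⁻¹ * (c₁ * s + c₀)) := by
    refine (hasHilbertReg_iff lam c₀ c₁ s _).2 ?_
    rw [add_sub_cancel_right]
    exact (Complex.continuous_im.tendsto _).comp (hL.comp (tendsto_radial_coneFilter s))
  rw [hH.hilbertReg_eq]
  refine ⟨hH, ?_⟩
  rw [add_sub_cancel_right, ← hre', ← inv_eq_of_mul_eq_one_right hLL, Complex.inv_re,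
    Complex.normSq_apply, hre, sq, sq]

/-- A measure carried by a countable set is the sum of its atoms, and the absolutely continuous part
does not charge points. -/
lemma singularPart_eq_sum (hlam : MemM2 lam) (hlam0 : lam ≠ 0) (hc₁ : 0 ≤ c₁) (hμ : MemM2 μ)
    (hb : 0 ≤ b) (hFG : ∀ z : ℂ, 0 < z.im → nevanlinna lam c₀ c₁ z * nevanlinna μ a b z = 1)
    (hZ : (atomSet lam c₀ c₁).Countable) :
    μ.singularPart volume = Measure.sum fun α : atomSet lam c₀ c₁ =>
      atomWeight lam c₁ (α : ℝ) • Measure.dirac (α : ℝ) := by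
  have := hμ.isLocallyFiniteMeasure
  have hmass : ∀ α ∈ atomSet lam c₀ c₁, μ.singularPart volume {α} = atomWeight lam c₁ α := by
    intro α hα
    have h1 := (hasHilbertReg_iff lam c₀ c₁ α _).1 hα.2
    rw [sub_self] at h1
    -- Membership in `atomSet` gives only a radial limit, so l is the image of the radius.
    rw [← measure_singleton_eq_atomWeight hlam hlam0 hμ hc₁ hFG
      (l := map (fun r : ℝ => cayleyPlane (r * (cayleyInv α : ℂ))) (𝓝[<] 1))
      (tendsto_radial_coneFilter α) h1]
    conv_rhs => rw [μ.haveLebesgueDecomposition_add volume]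
    have h2 : volume.withDensity (μ.rnDeriv volume) {α} = 0 :=
      withDensity_absolutelyContinuous _ _ (by simp)
    rw [Measure.add_apply, h2, add_zero]
  have hae := ae_singularPart_mem_atomSet hlam hc₁ hμ hb hFG
  rw [← Measure.restrict_eq_self_of_ae_mem hae]
  have hU : atomSet lam c₀ c₁ = ⋃ α ∈ atomSet lam c₀ c₁, {α} := by simp
  conv_lhs => rw [hU]
  rw [Measure.restrict_biUnion hZ (fun x _ y _ hxy => by simpa using hxy)
    measurableSet_singleton]
  congr 1
  funext α
  rw [Measure.restrict_singleton, hmass α α.2]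

end Dual

/-! ### Formulas for the dual triple, existence and uniqueness -/

theorem IsBreg.formulas {lam : Measure ℝ} (hlam : MemM2 lam) (hlam0 : lam ≠ 0)
    {c₀ c₁ : ℝ} (hc₁ : 0 ≤ c₁) (hZ : IsDiscreteSubset (criticalSetCircle lam c₀ c₁))
    {μ : Measure ℝ} {ζ₀ ζ₁ : ℝ} (h : IsBreg lam c₀ c₁ (μ, ζ₀, ζ₁)) :
      (∀ᵐ s : ℝ, HasHilbertReg lam s (hilbertReg lam s)) ∧
      (atomSet lam c₀ c₁).Countable ∧
      μ = volume.withDensity (fun s : ℝ => ENNReal.ofReal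
            (acDensity lam s /
              (acDensity lam s ^ 2 + (hilbertReg lam s - Real.pi⁻¹ * (c₁ * s + c₀)) ^ 2)))
          + Measure.sum (fun α : atomSet lam c₀ c₁ =>
              atomWeight lam c₁ (α : ℝ) • Measure.dirac (α : ℝ)) ∧
      ζ₀ = -Real.pi ^ 2 *
        ((((∫ s : ℝ, (1 + s ^ 2)⁻¹ ∂lam : ℝ) : ℂ) + c₁ - Complex.I * c₀)⁻¹).im ∧
      (c₁ = 0 → lam Set.univ < ⊤ → c₀ = ∫ s : ℝ, s / (1 + s ^ 2) ∂lam →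
        ζ₁ = Real.pi ^ 2 / (lam Set.univ).toReal) ∧
      (¬ (c₁ = 0 ∧ lam Set.univ < ⊤ ∧ c₀ = ∫ s : ℝ, s / (1 + s ^ 2) ∂lam) → ζ₁ = 0) := by
  obtain ⟨hμ, hb, hFG'⟩ := h
  have hFG : ∀ z : ℂ, 0 < z.im → nevanlinna lam c₀ c₁ z * nevanlinna μ ζ₀ ζ₁ z = 1 := hFG'
  have hcount := atomSet_countable hlam hc₁ hZ
  have hae := ae_boundary_values hlam hlam0 hc₁ hμ hFG
  have := MemM2.isLocallyFiniteMeasure hμ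
  refine ⟨hae.mono fun s hs => hs.1, hcount, ?_, dual_const_eq hFG, ?_,
    dual_slope_eq_zero hlam hμ hc₁ hFG⟩
  · conv_lhs => rw [μ.haveLebesgueDecomposition_add volume, add_comm]
    rw [singularPart_eq_sum hlam hlam0 hc₁ hμ hb hFG hcount, withDensity_acDensity]
    congr 1
    refine withDensity_congr_ae ?_
    filter_upwards [hae] with s hs
    rw [hs.2]
  · rintro rfl hfin h
    have : IsFiniteMeasure lam := ⟨hfin⟩
    exact dual_slope_eq hμ hlam0 hFG h

lemma exists_isBreg {lam : Measure ℝ} (hlam : MemM2 lam) (hlam0 : lam ≠ 0) (c₀ : ℝ) {c₁ : ℝ}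
    (hc₁ : 0 ≤ c₁) : ∃ T, IsBreg lam c₀ c₁ T := by
  have hpos : ∀ z : ℂ, 0 < z.im → 0 < (nevanlinna lam c₀ c₁ z).re := fun z hz =>
    re_nevanlinna_pos hlam hlam0 c₀ hc₁ hz
  have hne : ∀ z : ℂ, 0 < z.im → nevanlinna lam c₀ c₁ z ≠ 0 := fun z hz h => by
    have := hpos z hz
    simp [h] at this
  obtain ⟨μ, a, b, hμ, hb, h⟩ := exists_nevanlinna_eq (G := fun z => (nevanlinna lam c₀ c₁ z)⁻¹)
    ((differentiableOn_nevanlinna hlam c₀ c₁).inv hne) fun z hz => (re_inv_pos (hpos z hz)).le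
  refine ⟨(μ, a, b), hμ, hb, fun z hz => ?_⟩
  change nevanlinna lam c₀ c₁ z * nevanlinna μ a b z = 1
  rw [← h z hz, mul_inv_cancel₀ (hne z hz)]

theorem mainTheorem5 (lam : Measure ℝ) (hlam : MemM2 lam) (hlam0 : lam ≠ 0)
    (c₀ c₁ : ℝ) (hc₁ : 0 ≤ c₁)
    (hZ : IsDiscreteSubset (criticalSetCircle lam c₀ c₁)) :
    (∃! T : Measure ℝ × ℝ × ℝ, IsBreg lam c₀ c₁ T) ∧
    ∀ (μ : Measure ℝ) (ζ₀ ζ₁ : ℝ), IsBreg lam c₀ c₁ (μ, ζ₀, ζ₁) →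
      (∀ᵐ s : ℝ, HasHilbertReg lam s (hilbertReg lam s)) ∧
      (atomSet lam c₀ c₁).Countable ∧
      μ = volume.withDensity (fun s : ℝ => ENNReal.ofReal
            (acDensity lam s /
              (acDensity lam s ^ 2 + (hilbertReg lam s - Real.pi⁻¹ * (c₁ * s + c₀)) ^ 2)))
          + Measure.sum (fun α : atomSet lam c₀ c₁ =>
              atomWeight lam c₁ (α : ℝ) • Measure.dirac (α : ℝ)) ∧
      ζ₀ = -Real.pi ^ 2 *
        ((((∫ s : ℝ, (1 + s ^ 2)⁻¹ ∂lam : ℝ) : ℂ) + c₁ - Complex.I * c₀)⁻¹).im ∧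
      (c₁ = 0 → lam Set.univ < ⊤ → c₀ = ∫ s : ℝ, s / (1 + s ^ 2) ∂lam →
        ζ₁ = Real.pi ^ 2 / (lam Set.univ).toReal) ∧
      (¬ (c₁ = 0 ∧ lam Set.univ < ⊤ ∧ c₀ = ∫ s : ℝ, s / (1 + s ^ 2) ∂lam) → ζ₁ = 0) := by
  refine ⟨?_, fun μ ζ₀ ζ₁ h => IsBreg.formulas hlam hlam0 hc₁ hZ h⟩
  obtain ⟨T, hT⟩ := exists_isBreg hlam hlam0 c₀ hc₁
  refine ⟨T, hT, fun T' hT' => ?_⟩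
  obtain ⟨μ, a, b⟩ := T
  obtain ⟨μ', a', b'⟩ := T'
  -- Uniqueness: both triples satisfy formulas whose right-hand sides depend only on λ, c₀ and c₁.
  obtain ⟨-, -, h1, h2, h3, h4⟩ := IsBreg.formulas hlam hlam0 hc₁ hZ hT
  obtain ⟨-, -, h1', h2', h3', h4'⟩ := IsBreg.formulas hlam hlam0 hc₁ hZ hT'
  have hb : b' = b := by
    by_cases hc : c₁ = 0 ∧ lam Set.univ < ⊤ ∧ c₀ = ∫ s : ℝ, s / (1 + s ^ 2) ∂lam
    · rw [h3 hc.1 hc.2.1 hc.2.2, h3' hc.1 hc.2.1 hc.2.2]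
    · rw [h4 hc, h4' hc]
  rw [hb, h1'.trans h1.symm, h2'.trans h2.symm]
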